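/- Let $\mathbf S$ be a cartesian monoidal category, with terminal object $\star$, diagonals $\Delta_A\colon A\to A\times A$ and maps $\pi_A\colon A\to\star$; we also write $\pi_A$ for any projection of a product that discards the factor $A$. Let $\mathscr C$ be an $\mathbf S$-indexed symmetric monoidal category, that is, a pseudofunctor from $\mathbf S^{\mathrm{op}}$ to the 2-category of symmetric monoidal categories, strong symmetric monoidal functors and monoidal natural transformations. Write $\mathscr C^A$ for its fibres and $f^*\colon\mathscr C^B\to\mathscr C^A$ for the reindexing functor along $f\colon A\to B$, let $U$ be the unit object of $\mathscr C^\star$, and for $M\in\mathscr C^A$, $N\in\mathscr C^B$ let $M\boxtimes N=\pi_B^*M\otimes\pi_A^*N\in\mathscr C^{A\times B}$ be the external product. Assume that $\mathscr C$ has indexed homotopy coproducts: every $f^*$ has a left adjoint $f_!$, and for each of the following commutative squares, with $f\colon A\to B$ on top, $h\colon A\to C$ on the left, $g\colon B\to D$ on the right and $k\colon C\to D$ at the bottom, the Beck--Chevalley morphism $$f_!h^*\to f_!h^*k^*k_!\cong f_!f^*g^*k_!\to g^*k_!$$ is an isomorphism: 1. the squares with top $f\times\mathrm{id}_C$, left $\mathrm{id}_A\times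 g$, right $\mathrm{id}_B\times g$ and bottom $f\times\mathrm{id}_D$, for $f\colon A\to B$ and $g\colon C\to D$; 2. the squares with top and left $\Delta_A$, right $\mathrm{id}_A\times\Delta_A$ and bottom $\Delta_A\times\mathrm{id}_A$; 3. the squares with top $(\mathrm{id}_A,f)$, left $f$, right $f\times\mathrm{id}_B$ and bottom $\Delta_B$, for $f\colon A\to B$; 4. all squares obtained from these by transposition and by cartesian product with a fixed object. Assume also that $\otimes$ preserves these coproducts: for all $f\colon A\to B$, $M\in\mathscr C^B$ and $N\in\mathscr C^A$ the canonical map $$f_!(f^*M\otimes N)\to f_!(f^*M\otimes f^*f_!N)\cong f_!f^*(M\otimes f_!N)\to M\otimes f_!N$$ is an isomorphism. Then there is a bicategory $\mathscr C/\mathbf S$ whose 0-cells are the objects of $\mathbf S$ and whose hom-categories are $(\mathscr C/\mathbf S)(A,B)=\mathscr C^{A\times B}$, with composition functors and units $$M\odot N=(\mathrm{id}_A\times\pi_B\times\mathrm{id}_C)_!\,(\mathrm{id}_A\times\Delta_B\times\mathrm{id}_C)^*(M\boxtimes N),\qquad U_A=(\Delta_A)_!\,\pi_A^*U,$$ for $M\in\mathscr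 C^{A\times B}$ and $N\in\mathscr C^{B\times C}$. Moreover, this bicategory has a shadow with values in $\mathscr C^\star$ whose underlying functors $\mathscr C^{A\times A}\to\mathscr C^\star$ are $$\langle\!\langle M\rangle\!\rangle=(\pi_A)_!\,\Delta_A^*M.$$ Here a shadow on a bicategory with associativity isomorphisms $\mathfrak a\colon (M\odot N)\odot P\cong M\odot(N\odot P)$ and unit isomorphisms $\mathfrak l\colon U_R\odot M\cong M$, $\mathfrak r\colon M\odot U_R\cong M$ consists of functors $\langle\!\langle-\rangle\!\rangle$ from each endo-hom-category to a fixed category together with natural isomorphisms $\theta\colon\langle\!\langle M\odot N\rangle\!\rangle\cong\langle\!\langle N\odot M\rangle\!\rangle$ for $M\colon R\to S$, $N\colon S\to R$, such that $$\langle\!\langle\mathfrak a^{-1}\rangle\!\rangle\circ\theta_{M\odot N,P}=\theta_{N,P\odot M}\circ\langle\!\langle\mathfrak a\rangle\!\rangle\circ\theta_{M,N\odot P}\circ\langle\!\langle\mathfrak a\rangle\!\rangle$$ as maps $\langle\!\langle(M\odot N)\odot P\rangle\!\rangle\to\langle\!\langle(P\odot M)\odot N\rangle\!\rangle$ whenever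 they are defined, and $\langle\!\langle\mathfrak l\rangle\!\rangle\circ\theta_{M,U_R}=\langle\!\langle\mathfrak r\rangle\!\rangle$, $\langle\!\langle\mathfrak r\rangle\!\rangle\circ\theta_{U_R,M}=\langle\!\langle\mathfrak l\rangle\!\rangle$ for $M\colon R\to R$. -/

import Mathlib

open CategoryTheory MonoidalCategory CartesianMonoidalCategory

universe w w' u v u' v'

/-- An `S`-indexed symmetric monoidal category: a pseudofunctor from `Sᵒᵖ` to the 2-category of
symmetric monoidal categories, strong symmetric monoidal functors and monoidal natural
transformations, in elementary terms. The category `Fib A` is the fibre over `A`, the functor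
`pull f` is reindexing along `f`; it is strong symmetric monoidal, and the constraint
isomorphisms `pullId`, `pullComp` are monoidal and satisfy the coherence axioms of a
pseudofunctor. -/
structure IndexedSymMonCat (S : Type u) [Category.{v} S] where
  Fib : S → Type u'
  [cat : ∀ A, Category.{v'} (Fib A)]
  [mon : ∀ A, MonoidalCategory (Fib A)]
  [symm : ∀ A, SymmetricCategory (Fib A)]
  pull : ∀ {A B : S}, (A ⟶ B) → Fib B ⥤ Fib A
  [pullBraided : ∀ {A B : S} (f : A ⟶ B), (pull f).Braided]
  pullId : ∀ A : S, pull (𝟙 A) ≅ 𝟭 (Fib A)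
  pullComp : ∀ {A B C : S} (f : A ⟶ B) (g : B ⟶ C), pull (f ≫ g) ≅ pull g ⋙ pull f
  pullId_isMonoidal : ∀ A : S, NatTrans.IsMonoidal (pullId A).hom
  pullComp_isMonoidal : ∀ {A B C : S} (f : A ⟶ B) (g : B ⟶ C),
    NatTrans.IsMonoidal (pullComp f g).hom
  pull_assoc : ∀ {A B C D : S} (f : A ⟶ B) (g : B ⟶ C) (h : C ⟶ D) (M : Fib D),
    (pullComp (f ≫ g) h).hom.app M ≫ (pullComp f g).hom.app ((pull h).obj M) =
      eqToHom (congrArg (fun p => (pull p).obj M) (Category.assoc f g h)) ≫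
        (pullComp f (g ≫ h)).hom.app M ≫ (pull f).map ((pullComp g h).hom.app M)
  pull_id_comp : ∀ {A B : S} (f : A ⟶ B) (M : Fib B),
    (pullComp (𝟙 A) f).hom.app M ≫ (pullId A).hom.app ((pull f).obj M) =
      eqToHom (congrArg (fun p => (pull p).obj M) (Category.id_comp f))
  pull_comp_id : ∀ {A B : S} (f : A ⟶ B) (M : Fib B),
    (pullComp f (𝟙 B)).hom.app M ≫ (pull f).map ((pullId B).hom.app M) =
      eqToHom (congrArg (fun p => (pull p).obj M) (Category.comp_id f))

attribute [instance] IndexedSymMonCat.cat IndexedSymMonCat.mon IndexedSymMonCat.symm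
  IndexedSymMonCat.pullBraided

/-- The squares
```
  A ─f→ B
  |h    |g
  C ─k→ D
```
for which the Beck-Chevalley condition is required: "commutativity with reindexing", "the
Frobenius axiom", "sliding and splitting", together with their transposes and their cartesian
products with a fixed object. The arguments are, in this order, `f`, `h`, `g`, `k`. -/
inductive BasicHomotopyPullback {S : Type u} [Category.{v} S] [CartesianMonoidalCategory S] :
    ∀ {A B C D : S}, (A ⟶ B) → (A ⟶ C) → (B ⟶ D) → (C ⟶ D) → Prop
  | reindexing {A B C D : S} (f : A ⟶ B) (g : C ⟶ D) :
      BasicHomotopyPullback (f ▷ C) (A ◁ g) (B ◁ g) (f ▷ D)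
  | frobenius (A : S) :
      BasicHomotopyPullback (lift (𝟙 A) (𝟙 A)) (lift (𝟙 A) (𝟙 A))
        (A ◁ lift (𝟙 A) (𝟙 A)) (lift (𝟙 A) (𝟙 A) ▷ A ≫ (α_ A A A).hom)
  | sliding {A B : S} (f : A ⟶ B) :
      BasicHomotopyPullback (lift (𝟙 A) f) f (f ▷ B) (lift (𝟙 B) (𝟙 B))
  | transpose {A B C D : S} {f : A ⟶ B} {h : A ⟶ C} {g : B ⟶ D} {k : C ⟶ D} :
      BasicHomotopyPullback f h g k → BasicHomotopyPullback h f k g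
  | prodLeft (X : S) {A B C D : S} {f : A ⟶ B} {h : A ⟶ C} {g : B ⟶ D} {k : C ⟶ D} :
      BasicHomotopyPullback f h g k →
        BasicHomotopyPullback (X ◁ f) (X ◁ h) (X ◁ g) (X ◁ k)
  | prodRight (X : S) {A B C D : S} {f : A ⟶ B} {h : A ⟶ C} {g : B ⟶ D} {k : C ⟶ D} :
      BasicHomotopyPullback f h g k →
        BasicHomotopyPullback (f ▷ X) (h ▷ X) (g ▷ X) (k ▷ X)

namespace IndexedSymMonCat

section

variable {S : Type u} [Category.{v} S] (𝒞 : IndexedSymMonCat.{u, v, u', v'} S)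

theorem pull_assoc' {A B C D : S} (f : A ⟶ B) (g : B ⟶ C) (h : C ⟶ D) (M : 𝒞.Fib D) :
    (𝒞.pullComp f (g ≫ h)).hom.app M ≫ (𝒞.pull f).map ((𝒞.pullComp g h).hom.app M) ≫
      𝟙 _ ≫ (𝒞.pullComp f g).inv.app ((𝒞.pull h).obj M) ≫ (𝒞.pullComp (f ≫ g) h).inv.app M =
        eqToHom (congrArg (fun p => (𝒞.pull p).obj M) (Category.assoc f g h).symm) := by
  rw [← cancel_epi (eqToHom (congrArg (fun p => (𝒞.pull p).obj M) (Category.assoc f g h))),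
    Category.id_comp, ← Category.assoc, ← Category.assoc, Category.assoc (eqToHom _),
    ← 𝒞.pull_assoc]
  simp

/-- The pseudofunctor from `Sᵒᵖ` to `Cat` underlying an indexed symmetric monoidal category. -/
def toPseudofunctor : Pseudofunctor (LocallyDiscrete Sᵒᵖ) Cat.{v', u'} :=
  LocallyDiscrete.mkPseudofunctor
    (fun A => Cat.of (𝒞.Fib A.unop))
    (fun f => (𝒞.pull f.unop).toCatHom)
    (fun A => Cat.Hom.isoMk (𝒞.pullId A.unop))
    (fun f g => Cat.Hom.isoMk (𝒞.pullComp g.unop f.unop))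
    (by
      intro A B C D f g h
      ext (M : 𝒞.Fib _)
      refine Eq.trans ?_ (Cat.eqToHom_app _ _ _ _).symm
      exact 𝒞.pull_assoc' h.unop g.unop f.unop M)
    (by
      intro A B f
      ext (M : 𝒞.Fib _)
      refine Eq.trans ?_ (Cat.eqToHom_app _ _ _ _).symm
      exact (congrArg _ (Category.comp_id _)).trans (𝒞.pull_comp_id f.unop M))
    (by
      intro A B f
      ext (M : 𝒞.Fib _)
      refine Eq.trans ?_ (Cat.eqToHom_app _ _ _ _).symm
      exact (congrArg _ (Category.comp_id _)).trans (𝒞.pull_id_comp f.unop M))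

/-- For a commutative square `f ≫ g = h ≫ k`, the Beck-Chevalley morphism
`f_! h^* M ⟶ f_! h^* k^* k_! M ≅ f_! f^* g^* k_! M ⟶ g^* k_! M`. -/
def beckChevalley (push : ∀ {A B : S}, (A ⟶ B) → 𝒞.Fib A ⥤ 𝒞.Fib B)
    (adj : ∀ {A B : S} (f : A ⟶ B), push f ⊣ 𝒞.pull f)
    {A B C D : S} {f : A ⟶ B} {h : A ⟶ C} {g : B ⟶ D} {k : C ⟶ D} (w : f ≫ g = h ≫ k)
    (M : 𝒞.Fib C) :
    (push f).obj ((𝒞.pull h).obj M) ⟶ (𝒞.pull g).obj ((push k).obj M) :=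
  (push f).map ((𝒞.pull h).map ((adj k).unit.app M)) ≫
    (push f).map ((𝒞.pullComp h k).inv.app ((push k).obj M) ≫
      eqToHom (congrArg (fun p => (𝒞.pull p).obj ((push k).obj M)) w.symm) ≫
        (𝒞.pullComp f g).hom.app ((push k).obj M)) ≫
      (adj f).counit.app ((𝒞.pull g).obj ((push k).obj M))

end

variable {S : Type u} [Category.{v} S] [CartesianMonoidalCategory S]
  (𝒞 : IndexedSymMonCat.{u, v, u', v'} S)

/-- Indexed homotopy coproducts: left adjoints `f_! ⊣ f^*` satisfying the Beck-Chevalley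
condition for the squares in `BasicHomotopyPullback` (all of which commute). -/
structure IndexedHomotopyCoproducts where
  push : ∀ {A B : S}, (A ⟶ B) → 𝒞.Fib A ⥤ 𝒞.Fib B
  adj : ∀ {A B : S} (f : A ⟶ B), push f ⊣ 𝒞.pull f
  beckChevalley_isIso : ∀ {A B C D : S} {f : A ⟶ B} {h : A ⟶ C} {g : B ⟶ D} {k : C ⟶ D}
    (w : f ≫ g = h ≫ k), BasicHomotopyPullback f h g k →
      ∀ M : 𝒞.Fib C, IsIso (𝒞.beckChevalley push adj w M)

namespace IndexedHomotopyCoproducts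

variable {𝒞} (K : 𝒞.IndexedHomotopyCoproducts)

/-- The canonical map `f_! (f^* M ⊗ N) ⟶ f_! (f^* M ⊗ f^* f_! N) ≅ f_! f^* (M ⊗ f_! N) ⟶ M ⊗ f_! N`. -/
def projectionMap {A B : S} (f : A ⟶ B) (M : 𝒞.Fib B) (N : 𝒞.Fib A) :
    (K.push f).obj ((𝒞.pull f).obj M ⊗ N) ⟶ M ⊗ (K.push f).obj N :=
  (K.push f).map ((𝒞.pull f).obj M ◁ (K.adj f).unit.app N) ≫
    (K.push f).map (Functor.LaxMonoidal.μ (𝒞.pull f) M ((K.push f).obj N)) ≫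
      (K.adj f).counit.app (M ⊗ (K.push f).obj N)

/-- The tensor product preserves the indexed coproducts (the projection formula). -/
def PreservedByTensor : Prop :=
  ∀ {A B : S} (f : A ⟶ B) (M : 𝒞.Fib B) (N : 𝒞.Fib A), IsIso (K.projectionMap f M N)

end IndexedHomotopyCoproducts

/-- The external product `(M, N) ↦ M ⊠ N = π_B^* M ⊗ π_A^* N`. -/
def externalProduct (A B : S) : 𝒞.Fib A ⥤ 𝒞.Fib B ⥤ 𝒞.Fib (A ⊗ B) :=
  𝒞.pull (fst A B) ⋙ curriedTensor (𝒞.Fib (A ⊗ B)) ⋙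
    (Functor.whiskeringLeft _ _ _).obj (𝒞.pull (snd A B))

end IndexedSymMonCat

/-- `id_A × Δ_B × id_C`, that is `(a, b, c) ↦ ((a, b), (b, c))`. -/
def middleDiagonal {S : Type u} [Category.{v} S] [CartesianMonoidalCategory S] (A B C : S) :
    A ⊗ (B ⊗ C) ⟶ (A ⊗ B) ⊗ (B ⊗ C) :=
  lift (A ◁ fst B C) (snd A (B ⊗ C))

/-- `id_A × π_B × id_C`, that is `(a, b, c) ↦ (a, c)`. -/
def middleProjection {S : Type u} [Category.{v} S] [CartesianMonoidalCategory S] (A B C : S) :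
    A ⊗ (B ⊗ C) ⟶ A ⊗ C :=
  A ◁ snd B C

/-- A shadow functor on the bicategory `ℬ` with values in the category `T`. -/
structure ShadowFunctor {Ob : Type u} (ℬ : Bicategory.{w, v} Ob) (T : Type u') [Category.{v'} T]
    where
  sh : ∀ R : Ob, (R ⟶ R) ⥤ T
  θ : ∀ {R S : Ob} (M : R ⟶ S) (N : S ⟶ R), (sh R).obj (M ≫ N) ≅ (sh S).obj (N ≫ M)
  θ_natural_left : ∀ {R S : Ob} {M M' : R ⟶ S} (f : M ⟶ M') (N : S ⟶ R),
    (sh R).map (Bicategory.whiskerRight f N) ≫ (θ M' N).hom =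
      (θ M N).hom ≫ (sh S).map (Bicategory.whiskerLeft N f)
  θ_natural_right : ∀ {R S : Ob} (M : R ⟶ S) {N N' : S ⟶ R} (g : N ⟶ N'),
    (sh R).map (Bicategory.whiskerLeft M g) ≫ (θ M N').hom =
      (θ M N).hom ≫ (sh S).map (Bicategory.whiskerRight g M)
  hexagon : ∀ {R S Q : Ob} (M : R ⟶ S) (N : S ⟶ Q) (P : Q ⟶ R),
    (θ (M ≫ N) P).hom ≫ (sh Q).map (Bicategory.associator P M N).inv =
      (sh R).map (Bicategory.associator M N P).hom ≫ (θ M (N ≫ P)).hom ≫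
        (sh S).map (Bicategory.associator N P M).hom ≫ (θ N (P ≫ M)).hom
  unit_right : ∀ {R : Ob} (M : R ⟶ R),
    (θ M (𝟙 R)).hom ≫ (sh R).map (Bicategory.leftUnitor M).hom =
      (sh R).map (Bicategory.rightUnitor M).hom
  unit_left : ∀ {R : Ob} (M : R ⟶ R),
    (θ (𝟙 R) M).hom ≫ (sh R).map (Bicategory.rightUnitor M).hom =
      (sh R).map (Bicategory.leftUnitor M).hom

/-- The underlying data, without constraint isomorphisms, of a bicategory with 0-cells `Ob` and
a shadow with values in `T`: hom-categories, composition functors, units and shadow functors. -/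
structure ShadowedBicategoryData (Ob : Type u) (T : Type u') [Category.{v'} T] where
  Hom : Ob → Ob → Type w
  homCat : ∀ A B, Category.{w'} (Hom A B)
  comp : ∀ A B C, Hom A B ⥤ Hom B C ⥤ Hom A C
  unit : ∀ A, Hom A A
  shadow : ∀ A, Hom A A ⥤ T

/-- Forget the constraint isomorphisms of a bicategory with a shadow. -/
def ShadowFunctor.underlyingData {Ob : Type u} {ℬ : Bicategory.{w', w} Ob} {T : Type u'}
    [Category.{v'} T] (σ : ShadowFunctor ℬ T) : ShadowedBicategoryData.{w, w'} Ob T where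
  Hom A B := A ⟶ B
  homCat A B := ℬ.homCategory A B
  comp A B C := Bicategory.precomposing A B C
  unit A := 𝟙 A
  shadow A := σ.sh A

namespace IndexedSymMonCat.IndexedHomotopyCoproducts

variable {S : Type u} [Category.{v} S] [CartesianMonoidalCategory S]
  {𝒞 : IndexedSymMonCat.{u, v, u', v'} S} (K : 𝒞.IndexedHomotopyCoproducts)

/-- The functor `M, N ↦ M ⊙ N = (id_A × π_B × id_C)_! (id_A × Δ_B × id_C)^* (M ⊠ N)`. -/
def composition (A B C : S) : 𝒞.Fib (A ⊗ B) ⥤ 𝒞.Fib (B ⊗ C) ⥤ 𝒞.Fib (A ⊗ C) :=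
  𝒞.externalProduct (A ⊗ B) (B ⊗ C) ⋙
    (Functor.whiskeringRight _ _ _).obj
      (𝒞.pull (middleDiagonal A B C) ⋙ K.push (middleProjection A B C))

/-- `U_A = (Δ_A)_! π_A^* U`, where `U` is the unit object of the fibre over the terminal
object. -/
def unitCell (A : S) : 𝒞.Fib (A ⊗ A) :=
  (K.push (lift (𝟙 A) (𝟙 A))).obj ((𝒞.pull (toUnit A)).obj (𝟙_ (𝒞.Fib (𝟙_ S))))

/-- The functor `M ↦ ⟨M⟩ = (π_A)_! Δ_A^* M`. -/
def shadowFunctor (A : S) : 𝒞.Fib (A ⊗ A) ⥤ 𝒞.Fib (𝟙_ S) :=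
  𝒞.pull (lift (𝟙 A) (𝟙 A)) ⋙ K.push (toUnit A)

/-- Hom-categories `𝒞^{A × B}`, composition `⊙`, units `U_A` and shadows `⟨-⟩`. -/
def bicategoryData : ShadowedBicategoryData.{u', v'} S (𝒞.Fib (𝟙_ S)) where
  Hom A B := 𝒞.Fib (A ⊗ B)
  homCat _ _ := inferInstance
  comp := K.composition
  unit := K.unitCell
  shadow := K.shadowFunctor

end IndexedSymMonCat.IndexedHomotopyCoproducts

/-! An object of the fibre over A × B is treated as a matrix with entries M(a, b) = `ev M a b` at
generalized elements a : Z → A and b : Z → B. Then M ⊙ N is matrix multiplication, "the sum over b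
of M(a, b) ⊗ N(b, c)", U_A is the identity matrix, and the shadow is the trace, "the sum over a of
M(a, a)". These sums are encoded by cells M(a, b) ⊗ N(b, c) → (M ⊙ N)(a, c), 𝟙 → U_A(a, a) and M(a,
a) → ⟨M⟩ (`compCell`, `idCell`, `shadowCell`), all stable under substitution of generalized
elements.

The cells are universal (`Opcart`): maps out of a sum correspond to maps out of its summands over
the larger context. The Beck-Chevalley condition makes universality stable under base change
(`preservesOpcart`), the projection formula makes it stable under tensoring with objects that do not
depend on the summed variable (`opcart_whiskerLeft`, `opcart_whiskerRight`), and universal cells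
compose (`Opcart.comp`). So iterated cells such as (M(a, b) ⊗ N(b, c)) ⊗ P(c, d) → ((M ⊙ N) ⊙ P)(a,
d) are again universal.

Universal cells with isomorphic sources over the same map have isomorphic targets
(`Opcart.exists_iso`). This gives the associator and the shadow isomorphism; the unit isomorphisms
arise because a universal cell over an identity is invertible. Each constraint is characterized by
its effect on cells, where it is the associator, unitor or braiding of a fibre. Every axiom can be
tested on cells (`hom_ext₂`, `hom_ext₃`, `hom_ext₄` and their shadow versions), where it becomes an
identity in a symmetric monoidal category. -/

namespace IndexedSymMonCat

/-! ### Calculus of chosen pullbacks and restriction of morphisms. -/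

section

variable {S : Type u} [Category.{v} S] (𝒞 : IndexedSymMonCat.{u, v, u', v'} S)

/-- The comparison `h^* ≅ f^* g^*` for a factorization `h = f ≫ g`. -/
def pullFac {A B C : S} {f : A ⟶ B} {g : B ⟶ C} {h : A ⟶ C} (w : f ≫ g = h) :
    𝒞.pull h ≅ 𝒞.pull g ⋙ 𝒞.pull f :=
  eqToIso (congrArg (fun p => 𝒞.pull p) w.symm) ≪≫ 𝒞.pullComp f g

theorem pullFac_rfl {A B C : S} (f : A ⟶ B) (g : B ⟶ C) :
    𝒞.pullFac (rfl : f ≫ g = f ≫ g) = 𝒞.pullComp f g := by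
  ext; simp [pullFac]

/-- With every composite a variable and every factorization a hypothesis, the transport in the
pseudofunctor axiom disappears. All later coherence of reindexing goes through this form. -/
theorem pullFac_assoc {A B C D : S} {f : A ⟶ B} {g : B ⟶ C} {k : C ⟶ D} {fg : A ⟶ C}
    {gk : B ⟶ D} {fgk : A ⟶ D} (w₁ : f ≫ g = fg) (w₂ : g ≫ k = gk) (w₃ : f ≫ gk = fgk)
    (w₄ : fg ≫ k = fgk) (M : 𝒞.Fib D) :
    (𝒞.pullFac w₄).hom.app M ≫ (𝒞.pullFac w₁).hom.app ((𝒞.pull k).obj M) =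
      (𝒞.pullFac w₃).hom.app M ≫ (𝒞.pull f).map ((𝒞.pullFac w₂).hom.app M) := by
  subst w₁ w₂ w₄
  simpa [pullFac] using 𝒞.pull_assoc f g k M

instance pullFac_isMonoidal {A B C : S} {f : A ⟶ B} {g : B ⟶ C} {h : A ⟶ C} (w : f ≫ g = h) :
    NatTrans.IsMonoidal (𝒞.pullFac w).hom := by
  subst w
  rw [pullFac_rfl]
  exact 𝒞.pullComp_isMonoidal f g

variable {𝒞}

/-- The cartesian comparison `h^* M ≅ f^* (g^* M)`. -/
def cartPull {A B C : S} {f : A ⟶ B} {g : B ⟶ C} {h : A ⟶ C} (w : f ≫ g = h) (M : 𝒞.Fib C) :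
    (𝒞.pull h).obj M ≅ (𝒞.pull f).obj ((𝒞.pull g).obj M) :=
  (𝒞.pullFac w).app M

/-- The tensor product of cartesian comparisons. -/
def cartTensor {Z W : S} {g : Z ⟶ W} {T R : 𝒞.Fib W} {T' R' : 𝒞.Fib Z}
    (c : T' ≅ (𝒞.pull g).obj T) (d : R' ≅ (𝒞.pull g).obj R) :
    T' ⊗ R' ≅ (𝒞.pull g).obj (T ⊗ R) :=
  (c ⊗ᵢ d) ≪≫ Functor.Monoidal.μIso (𝒞.pull g) T R

/-- The cartesian comparison of unit objects. -/
def cartUnit {Z W : S} (g : Z ⟶ W) : 𝟙_ (𝒞.Fib Z) ≅ (𝒞.pull g).obj (𝟙_ (𝒞.Fib W)) :=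
  Functor.Monoidal.εIso (𝒞.pull g)

/-- Composition of cartesian comparisons. -/
def cartComp {Y Z W : S} {h : Y ⟶ Z} {g : Z ⟶ W} {k : Y ⟶ W} (w : h ≫ g = k) {T : 𝒞.Fib W}
    {T' : 𝒞.Fib Z} {T'' : 𝒞.Fib Y} (d : T'' ≅ (𝒞.pull h).obj T') (c : T' ≅ (𝒞.pull g).obj T) :
    T'' ≅ (𝒞.pull k).obj T :=
  d ≪≫ (𝒞.pull h).mapIso c ≪≫ (cartPull w T).symm

/-- Restriction of a morphism along `g`, between chosen pullbacks of its source and target. -/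
def res {Z W : S} {g : Z ⟶ W} {T R : 𝒞.Fib W} {T' R' : 𝒞.Fib Z}
    (c : T' ≅ (𝒞.pull g).obj T) (d : R' ≅ (𝒞.pull g).obj R) (φ : T ⟶ R) : T' ⟶ R' :=
  c.hom ≫ (𝒞.pull g).map φ ≫ d.inv

section cartComp

variable {Y Z W : S} {h : Y ⟶ Z} {g : Z ⟶ W} {k : Y ⟶ W} (w : h ≫ g = k)

theorem cartPull_naturality {M N : 𝒞.Fib W} (f : M ⟶ N) :
    (cartPull w M).hom ≫ (𝒞.pull h).map ((𝒞.pull g).map f) =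
      (𝒞.pull k).map f ≫ (cartPull w N).hom :=
  ((𝒞.pullFac w).hom.naturality f).symm

theorem cartPull_inv_naturality {M N : 𝒞.Fib W} (f : M ⟶ N) :
    (cartPull w M).inv ≫ (𝒞.pull k).map f =
      (𝒞.pull h).map ((𝒞.pull g).map f) ≫ (cartPull w N).inv :=
  ((𝒞.pullFac w).inv.naturality f).symm

theorem cartComp_assoc {V : S} {x : W ⟶ V} {y : Z ⟶ V} {z : Y ⟶ V} (w₁ : h ≫ y = z)
    (w₂ : g ≫ x = y) (w₃ : k ≫ x = z) {M : 𝒞.Fib V} {M' : 𝒞.Fib W} {M'' : 𝒞.Fib Z}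
    {M₃ : 𝒞.Fib Y} (a : M₃ ≅ (𝒞.pull h).obj M'') (b : M'' ≅ (𝒞.pull g).obj M')
    (c : M' ≅ (𝒞.pull x).obj M) :
    cartComp w₃ (cartComp w a b) c = cartComp w₁ a (cartComp w₂ b c) := by
  ext
  have : (cartPull w ((𝒞.pull x).obj M)).inv ≫ (cartPull w₃ M).inv =
      (𝒞.pull h).map (cartPull w₂ M).inv ≫ (cartPull w₁ M).inv := by
    have h : cartPull w₃ M ≪≫ cartPull w ((𝒞.pull x).obj M) =
        cartPull w₁ M ≪≫ (𝒞.pull h).mapIso (cartPull w₂ M) :=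
      Iso.ext (𝒞.pullFac_assoc w w₂ w₁ w₃ M)
    exact congrArg Iso.inv h
  simp [cartComp, reassoc_of% cartPull_inv_naturality w, this]

theorem cartComp_cartPull {V : S} {x : W ⟶ V} {y : Z ⟶ V} {z : Y ⟶ V} (w₁ : h ≫ y = z)
    (w₂ : g ≫ x = y) (w₃ : k ≫ x = z) (M : 𝒞.Fib V) :
    cartComp w (cartPull w₁ M) (cartPull w₂ M) = cartPull w₃ M := by
  ext
  have := 𝒞.pullFac_assoc w w₂ w₁ w₃ M
  simp only [cartComp, cartPull, Iso.trans_hom, Iso.symm_hom, Functor.mapIso_hom, Iso.app_hom,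
    Iso.app_inv]
  rw [← Category.assoc, ← this]
  simp

/-- This is where monoidality of the constraint `pullComp` enters. -/
theorem μ_comp_map_μ_comp_cartPull_inv (T R : 𝒞.Fib W) :
    Functor.LaxMonoidal.μ (𝒞.pull h) _ _ ≫
        (𝒞.pull h).map (Functor.LaxMonoidal.μ (𝒞.pull g) T R) ≫ (cartPull w (T ⊗ R)).inv =
      ((cartPull w T).inv ⊗ₘ (cartPull w R).inv) ≫ Functor.LaxMonoidal.μ (𝒞.pull k) T R := by
  have := NatTrans.IsMonoidal.tensor (τ := (𝒞.pullFac w).hom) T R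
  rw [← cancel_epi ((cartPull w T).hom ⊗ₘ (cartPull w R).hom), ← Category.assoc, ← Category.assoc,
    Iso.comp_inv_eq, MonoidalCategory.tensorHom_comp_tensorHom_assoc]
  simp [cartPull, Functor.LaxMonoidal.comp_μ] at this ⊢

theorem cartComp_cartTensor {T R : 𝒞.Fib W} {T' R' : 𝒞.Fib Z} {T'' R'' : 𝒞.Fib Y}
    (d : T'' ≅ (𝒞.pull h).obj T') (c : T' ≅ (𝒞.pull g).obj T)
    (d' : R'' ≅ (𝒞.pull h).obj R') (c' : R' ≅ (𝒞.pull g).obj R) :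
    cartComp w (cartTensor d d') (cartTensor c c') =
      cartTensor (cartComp w d c) (cartComp w d' c') := by
  ext
  have := μ_comp_map_μ_comp_cartPull_inv w T R
  simp only [cartComp, cartTensor, Iso.trans_hom, Functor.mapIso_hom, Iso.symm_hom,
    Category.assoc, Functor.map_comp, tensorIso_hom, Functor.Monoidal.μIso_hom,
    ← Functor.LaxMonoidal.μ_natural_assoc, this, ← tensorHom_comp_tensorHom]

theorem cartComp_cartUnit :
    cartComp w (cartUnit (𝒞 := 𝒞) h) (cartUnit g) = cartUnit k := by
  ext
  have := NatTrans.IsMonoidal.unit (τ := (𝒞.pullFac w).hom)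
  simp only [cartComp, cartUnit, cartPull, Iso.trans_hom, Functor.mapIso_hom, Iso.symm_hom,
    Functor.Monoidal.εIso_hom, Iso.app_inv]
  rw [← Category.assoc, ← Iso.app_inv, Iso.comp_inv_eq]
  simp [Functor.LaxMonoidal.comp_ε] at this ⊢

theorem cartComp_right_injective {T : 𝒞.Fib W} {T' : 𝒞.Fib Z} {T'' : 𝒞.Fib Y}
    {d d' : T'' ≅ (𝒞.pull h).obj T'} {c : T' ≅ (𝒞.pull g).obj T}
    (H : cartComp w d c = cartComp w d' c) : d = d' := by
  ext
  simpa [cartComp, cancel_mono] using congrArg Iso.hom H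

theorem cartComp_hom {T : 𝒞.Fib W} {T' : 𝒞.Fib Z} {T'' : 𝒞.Fib Y}
    (d : T'' ≅ (𝒞.pull h).obj T') (c : T' ≅ (𝒞.pull g).obj T) :
    (cartComp w d c).hom ≫ (cartPull w T).hom = d.hom ≫ (𝒞.pull h).map c.hom := by
  simp [cartComp]

/-- Since pullbacks are arbitrary objects with a comparison isomorphism, iterated restriction is a
single restriction on the nose, with no constraint isomorphism left between the two sides. -/
theorem res_res {T R : 𝒞.Fib W} {T' R' : 𝒞.Fib Z} {T'' R'' : 𝒞.Fib Y}
    (d : T'' ≅ (𝒞.pull h).obj T') (c : T' ≅ (𝒞.pull g).obj T)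
    (d' : R'' ≅ (𝒞.pull h).obj R') (c' : R' ≅ (𝒞.pull g).obj R) (φ : T ⟶ R) :
    res d d' (res c c' φ) = res (cartComp w d c) (cartComp w d' c') φ := by
  simp [res, cartComp, reassoc_of% cartPull_inv_naturality w]

end cartComp

section res

variable {Z W : S} {g : Z ⟶ W}

theorem res_comp {T R Q : 𝒞.Fib W} {T' R' Q' : 𝒞.Fib Z} (c : T' ≅ (𝒞.pull g).obj T)
    (d : R' ≅ (𝒞.pull g).obj R) (e : Q' ≅ (𝒞.pull g).obj Q) (φ : T ⟶ R) (ψ : R ⟶ Q) :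
    res c e (φ ≫ ψ) = res c d φ ≫ res d e ψ := by
  simp [res]

theorem res_id {T : 𝒞.Fib W} {T' : 𝒞.Fib Z} (c : T' ≅ (𝒞.pull g).obj T) :
    res c c (𝟙 T) = 𝟙 T' := by
  simp [res]

instance {T R : 𝒞.Fib W} {T' R' : 𝒞.Fib Z} (c : T' ≅ (𝒞.pull g).obj T)
    (d : R' ≅ (𝒞.pull g).obj R) (φ : T ⟶ R) [IsIso φ] : IsIso (res c d φ) := by
  unfold res; infer_instance

theorem res_cartPull {V : S} {x : W ⟶ V} {y : Z ⟶ V} (w : g ≫ x = y) {M N : 𝒞.Fib V}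
    (f : M ⟶ N) :
    res (cartPull w M) (cartPull w N) ((𝒞.pull x).map f) = (𝒞.pull y).map f := by
  simp [res, reassoc_of% cartPull_naturality w]

variable {T T₁ T₂ R R₁ R₂ : 𝒞.Fib W} {T' T₁' T₂' R' R₁' R₂' : 𝒞.Fib Z}

theorem res_eq_iff (c : T' ≅ (𝒞.pull g).obj T) (d : R' ≅ (𝒞.pull g).obj R) (φ : T ⟶ R)
    (ψ : T' ⟶ R') : res c d φ = ψ ↔ c.hom ≫ (𝒞.pull g).map φ = ψ ≫ d.hom := by
  rw [res, ← Category.assoc, Iso.comp_inv_eq]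

/-- Reindexing is strong symmetric monoidal, so this lemma and the following ones let restriction
pass through whiskerings, associators, braidings and unitors as if it were strict. -/
theorem res_whiskerRight (c : T' ≅ (𝒞.pull g).obj T) (d : R' ≅ (𝒞.pull g).obj R)
    (c₁ : T₁' ≅ (𝒞.pull g).obj T₁) (φ : T ⟶ R) :
    res (cartTensor c c₁) (cartTensor d c₁) (φ ▷ T₁) = res c d φ ▷ T₁' := by
  rw [res_eq_iff, res]
  simp [cartTensor, MonoidalCategory.tensorHom_def, ← whisker_exchange_assoc ((𝒞.pull g).map φ)]

theorem res_whiskerLeft (c : T' ≅ (𝒞.pull g).obj T) (d : R' ≅ (𝒞.pull g).obj R)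
    (c₁ : T₁' ≅ (𝒞.pull g).obj T₁) (φ : T ⟶ R) :
    res (cartTensor c₁ c) (cartTensor c₁ d) (T₁ ◁ φ) = T₁' ◁ res c d φ := by
  rw [res_eq_iff, res]
  simp [cartTensor, MonoidalCategory.tensorHom_def', whisker_exchange_assoc c₁.hom]

theorem res_associator_hom (c : T' ≅ (𝒞.pull g).obj T) (c₁ : T₁' ≅ (𝒞.pull g).obj T₁)
    (c₂ : T₂' ≅ (𝒞.pull g).obj T₂) :
    res (cartTensor (cartTensor c c₁) c₂) (cartTensor c (cartTensor c₁ c₂)) (α_ T T₁ T₂).hom =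
      (α_ T' T₁' T₂').hom := by
  have h₁ : ((c.hom ⊗ₘ c₁.hom) ≫ Functor.LaxMonoidal.μ (𝒞.pull g) T T₁) ⊗ₘ c₂.hom =
      ((c.hom ⊗ₘ c₁.hom) ⊗ₘ c₂.hom) ≫ Functor.LaxMonoidal.μ (𝒞.pull g) T T₁ ▷ _ := by
    rw [← tensorHom_id, tensorHom_comp_tensorHom, Category.comp_id]
  have h₂ : c.hom ⊗ₘ ((c₁.hom ⊗ₘ c₂.hom) ≫ Functor.LaxMonoidal.μ (𝒞.pull g) T₁ T₂) =
      (c.hom ⊗ₘ c₁.hom ⊗ₘ c₂.hom) ≫ _ ◁ Functor.LaxMonoidal.μ (𝒞.pull g) T₁ T₂ := by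
    rw [← id_tensorHom, tensorHom_comp_tensorHom, Category.comp_id]
  simp only [res_eq_iff, cartTensor, Iso.trans_hom, tensorIso_hom, Functor.Monoidal.μIso_hom, h₁,
    h₂, Category.assoc, Functor.LaxMonoidal.associativity,
    MonoidalCategory.associator_naturality_assoc]

theorem res_associator_inv (c : T' ≅ (𝒞.pull g).obj T) (c₁ : T₁' ≅ (𝒞.pull g).obj T₁)
    (c₂ : T₂' ≅ (𝒞.pull g).obj T₂) :
    res (cartTensor c (cartTensor c₁ c₂)) (cartTensor (cartTensor c c₁) c₂) (α_ T T₁ T₂).inv =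
      (α_ T' T₁' T₂').inv := by
  rw [← cancel_mono (α_ T' T₁' T₂').hom, Iso.inv_hom_id, ← res_associator_hom c c₁ c₂, ← res_comp,
    Iso.inv_hom_id, res_id]

theorem res_braiding_hom (c : T' ≅ (𝒞.pull g).obj T) (c₁ : T₁' ≅ (𝒞.pull g).obj T₁) :
    res (cartTensor c c₁) (cartTensor c₁ c) (β_ T T₁).hom = (β_ T' T₁').hom := by
  simp [res_eq_iff, cartTensor]

theorem res_leftUnitor_inv (c : T' ≅ (𝒞.pull g).obj T) :
    res c (cartTensor (cartUnit g) c) (λ_ T).inv = (λ_ T').inv := by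
  simp [res_eq_iff, cartTensor, cartUnit, MonoidalCategory.tensorHom_def']

theorem res_rightUnitor_inv (c : T' ≅ (𝒞.pull g).obj T) :
    res c (cartTensor c (cartUnit g)) (ρ_ T).inv = (ρ_ T').inv := by
  simp [res_eq_iff, cartTensor, cartUnit, MonoidalCategory.tensorHom_def]

end res

end

end IndexedSymMonCat

/-! ### Opcartesian cells: uniqueness, composition and base change. -/

namespace IndexedSymMonCat

section

variable {S : Type u} [Category.{v} S] {𝒞 : IndexedSymMonCat.{u, v, u', v'} S}

/-- A cell `u` from `T` to a pullback `P'` of `P` along `f` is opcartesian if morphisms out of `P`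
in the fibre correspond to morphisms from `T` to pullbacks along `f`. -/
def Opcart {X Y : S} {f : X ⟶ Y} {T P' : 𝒞.Fib X} {P : 𝒞.Fib Y} (c : P' ≅ (𝒞.pull f).obj P)
    (u : T ⟶ P') : Prop :=
  ∀ R : 𝒞.Fib Y, Function.Bijective (fun φ : P ⟶ R => u ≫ c.hom ≫ (𝒞.pull f).map φ)

namespace Opcart

variable {X Y : S} {f : X ⟶ Y} {T P' : 𝒞.Fib X} {P : 𝒞.Fib Y} {c : P' ≅ (𝒞.pull f).obj P}
  {u : T ⟶ P'}

theorem hom_ext (hu : Opcart c u) {R : 𝒞.Fib Y} {R' : 𝒞.Fib X} (d : R' ≅ (𝒞.pull f).obj R)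
    {φ ψ : P ⟶ R} (h : u ≫ res c d φ = u ≫ res c d ψ) : φ = ψ := by
  apply (hu R).1
  simpa [res, ← Category.assoc] using h

theorem iff_refl : Opcart c u ↔ Opcart (Iso.refl _) (u ≫ c.hom) := by
  simp [Opcart]

theorem precomp_iso (hu : Opcart c u) {T' : 𝒞.Fib X} (e : T' ⟶ T) [IsIso e] :
    Opcart c (e ≫ u) := by
  intro R
  have : (fun φ : P ⟶ R => (e ≫ u) ≫ c.hom ≫ (𝒞.pull f).map φ) =
      (fun ψ => e ≫ ψ) ∘ fun φ : P ⟶ R => u ≫ c.hom ≫ (𝒞.pull f).map φ := by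
    ext; simp
  rw [this]
  exact Function.Bijective.comp ⟨fun a b h => (cancel_epi e).1 h, fun b => ⟨inv e ≫ b, by simp⟩⟩
    (hu R)

/-- The two defining bijections compose, up to the comparison k^* ≅ f^* g^*. -/
theorem comp (hu : Opcart c u) {Z : S} {g : Y ⟶ Z} {k : X ⟶ Z} (w : f ≫ g = k) {Q' : 𝒞.Fib Y}
    {Q : 𝒞.Fib Z} {d : Q' ≅ (𝒞.pull g).obj Q} {v : P ⟶ Q'} (hv : Opcart d v) {Q'' : 𝒞.Fib X}
    (e : Q'' ≅ (𝒞.pull f).obj Q') : Opcart (cartComp w e d) (u ≫ res c e v) := by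
  intro R
  have : (fun φ : Q ⟶ R => (u ≫ res c e v) ≫ (cartComp w e d).hom ≫ (𝒞.pull k).map φ) =
      (fun ψ => ψ ≫ (cartPull w R).inv) ∘ (fun ψ => u ≫ c.hom ≫ (𝒞.pull f).map ψ) ∘
        fun φ : Q ⟶ R => v ≫ d.hom ≫ (𝒞.pull g).map φ := by
    ext
    simp [res, cartComp, cartPull_inv_naturality]
  rw [this]
  refine Function.Bijective.comp ⟨fun a b h => by simpa using h, fun b => ⟨b ≫
    (cartPull w R).hom, by simp⟩⟩ ((hu _).comp (hv R))

theorem isIso_of_comp (hu : Opcart c u) {Q Q' : 𝒞.Fib _} {d : Q' ≅ (𝒞.pull f).obj Q}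
    {φ : P ⟶ Q} (h : Opcart d (u ≫ res c d φ)) : IsIso φ := by
  obtain ⟨ψ, hψ⟩ := (h P).2 (u ≫ c.hom)
  have hψ : u ≫ res c d φ ≫ res d c ψ = u := by
    rw [← cancel_mono c.hom]
    simpa [res] using hψ
  have h₁ : φ ≫ ψ = 𝟙 P := hu.hom_ext c (by rw [res_id, res_comp c d, hψ, Category.comp_id])
  refine ⟨ψ, h₁, h.hom_ext d ?_⟩
  rw [res_comp d c, Category.assoc, ← Category.assoc (res c d φ), ← res_comp, h₁, res_id, res_id,
    Category.id_comp, Category.comp_id]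

/-- The comparison of two opcartesian cells with the same source. -/
theorem exists_iso (hu : Opcart c u) {Q : 𝒞.Fib Y} {Q' : 𝒞.Fib X} {d : Q' ≅ (𝒞.pull f).obj Q}
    {v : T ⟶ Q'} (hv : Opcart d v) : ∃ e : P ≅ Q, u ≫ res c d e.hom = v := by
  obtain ⟨φ, hφ⟩ := (hu Q).2 (v ≫ d.hom)
  have hφ : u ≫ res c d φ = v := by
    rw [← cancel_mono d.hom]
    simpa [res] using hφ
  have := isIso_of_comp hu (φ := φ) (d := d) (hφ ▸ hv)
  exact ⟨asIso φ, hφ⟩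

theorem postcomp_iso (hu : Opcart c u) {Q : 𝒞.Fib Y} {Q' : 𝒞.Fib X}
    (d : Q' ≅ (𝒞.pull f).obj Q) (e : P ⟶ Q) [IsIso e] : Opcart d (u ≫ res c d e) := by
  intro R
  have : (fun φ : Q ⟶ R => (u ≫ res c d e) ≫ d.hom ≫ (𝒞.pull f).map φ) =
      (fun ψ => u ≫ c.hom ≫ (𝒞.pull f).map ψ) ∘ fun φ : Q ⟶ R => e ≫ φ := by
    ext; simp [res]
  rw [this]
  exact (hu R).comp ⟨fun a b h => (cancel_epi e).1 h, fun b => ⟨inv e ≫ b, by simp⟩⟩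

end Opcart

/-- Reindexing along an isomorphism is an equivalence. -/
theorem isEquivalence_pull {A B : S} (f : A ⟶ B) [IsIso f] : (𝒞.pull f).IsEquivalence :=
  (CategoryTheory.Equivalence.mk (𝒞.pull f) (𝒞.pull (inv f))
    ((𝒞.pullId B).symm ≪≫ 𝒞.pullFac (IsIso.inv_hom_id f))
    ((𝒞.pullFac (IsIso.hom_inv_id f)).symm ≪≫ 𝒞.pullId A)).isEquivalence_functor

theorem opcart_id (T : 𝒞.Fib X) : Opcart ((𝒞.pullId X).symm.app T) (𝟙 T) := by
  intro R
  have : (fun φ : T ⟶ R => 𝟙 T ≫ ((𝒞.pullId X).symm.app T).hom ≫ (𝒞.pull (𝟙 X)).map φ) =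
      fun φ => φ ≫ (𝒞.pullId X).inv.app R := by
    ext φ
    simpa using ((𝒞.pullId X).inv.naturality φ).symm
  rw [this]
  exact ⟨fun a b h => (cancel_mono _).1 h, fun b => ⟨b ≫ (𝒞.pullId X).hom.app R, by simp⟩⟩

theorem Opcart.isIso_of_id {X : S} {f : X ⟶ X} (hf : f = 𝟙 X) {T P' : 𝒞.Fib X} {P : 𝒞.Fib X}
    {c : P' ≅ (𝒞.pull f).obj P} {u : T ⟶ P'} (hu : Opcart c u) : IsIso u := by
  subst hf
  obtain ⟨e, he⟩ := (opcart_id T).exists_iso hu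
  rw [← he, Category.id_comp]
  infer_instance

/-- Base change along the square preserves opcartesian cells. -/
structure PreservesOpcart (𝒞 : IndexedSymMonCat.{u, v, u', v'} S) {A B C D : S} {f : A ⟶ B}
    {h : A ⟶ C} {g : B ⟶ D} {k : C ⟶ D} (w : f ≫ g = h ≫ k) : Prop where
  opcart_res : ∀ {T P' : 𝒞.Fib C} {P : 𝒞.Fib D} (c : P' ≅ (𝒞.pull k).obj P) (u : T ⟶ P'), Opcart c u →
    ∀ {T' P'' : 𝒞.Fib A} {Q : 𝒞.Fib B} (t : T' ≅ (𝒞.pull h).obj T)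
      (p : P'' ≅ (𝒞.pull h).obj P') (q : Q ≅ (𝒞.pull g).obj P) (e : P'' ≅ (𝒞.pull f).obj Q),
      cartComp rfl p c = cartComp w e q → Opcart e (res t p u)

section

variable {A B C D : S} {f : A ⟶ B} {h : A ⟶ C} {g : B ⟶ D} {k : C ⟶ D} (w : f ≫ g = h ≫ k)

theorem exists_cartComp_eq {m : A ⟶ D} {w : f ≫ g = m} {P : 𝒞.Fib D} {P'' : 𝒞.Fib A}
    {Q : 𝒞.Fib B} (q : Q ≅ (𝒞.pull g).obj P) (r : P'' ≅ (𝒞.pull m).obj P) :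
    ∃ e : P'' ≅ (𝒞.pull f).obj Q, cartComp w e q = r :=
  ⟨r ≪≫ cartPull w P ≪≫ (𝒞.pull f).mapIso q.symm, by ext; simp [cartComp]⟩

/-- Opcartesian cells out of T are unique up to isomorphism, and so are all chosen pullbacks; hence
one cell and one set of choices per T suffice. -/
theorem PreservesOpcart.of_exists
    (H : ∀ T : 𝒞.Fib C, ∃ (P' : 𝒞.Fib C) (P : 𝒞.Fib D) (c : P' ≅ (𝒞.pull k).obj P) (u : T ⟶ P'),
      Opcart c u ∧ ∃ (T' P'' : 𝒞.Fib A) (Q : 𝒞.Fib B) (t : T' ≅ (𝒞.pull h).obj T)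
      (p : P'' ≅ (𝒞.pull h).obj P') (q : Q ≅ (𝒞.pull g).obj P) (e : P'' ≅ (𝒞.pull f).obj Q),
      cartComp rfl p c = cartComp w e q ∧ Opcart e (res t p u)) : 𝒞.PreservesOpcart w := by
  constructor
  intro T P' P c u hu T' P'' Q t p q e he
  obtain ⟨P₀', P₀, c₀, u₀, hu₀, T₀', P₀'', Q₀, t₀, p₀, q₀, e₀, he₀, H₀⟩ := H T
  obtain ⟨φ, rfl⟩ := hu₀.exists_iso hu
  have : res t p (u₀ ≫ res c₀ c φ.hom) =
      (t.hom ≫ t₀.inv) ≫ res t₀ p₀ u₀ ≫ res e₀ e (res q₀ q φ.hom) := by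
    rw [res_res w, ← he, ← he₀, ← res_res, ← res_comp]
    simp [res]
  rw [this]
  exact (H₀.postcomp_iso e (res q₀ q φ.hom)).precomp_iso _

theorem PreservesOpcart.of_isIso [IsIso h] [IsIso g] : 𝒞.PreservesOpcart w := by
  constructor
  intro T P' P c u hu T' P'' Q t p q e he R
  have := isEquivalence_pull (𝒞 := 𝒞) h
  have := isEquivalence_pull (𝒞 := 𝒞) g
  -- As g^* is an equivalence, each test object R comes from D. Full faithfulness of g^* and h^*
  -- then carries the bijection for `u` to the required one.
  let d : R ≅ (𝒞.pull g).obj ((𝒞.pull g).objPreimage R) :=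
    ((𝒞.pull g).objObjPreimageIso R).symm
  have key : (fun φ : Q ⟶ R => res t p u ≫ e.hom ≫ (𝒞.pull f).map φ) ∘
        (fun ψ => q.hom ≫ ψ ≫ d.inv) ∘
        (fun ψ : P ⟶ (𝒞.pull g).objPreimage R => (𝒞.pull g).map ψ) =
      (fun ψ => t.hom ≫ ψ ≫ (cartPull (rfl : h ≫ k = _) _).inv ≫ (cartPull w _).hom ≫
        (𝒞.pull f).map d.inv) ∘ (fun ψ => (𝒞.pull h).map ψ) ∘
        fun ψ => u ≫ c.hom ≫ (𝒞.pull k).map ψ := by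
    have he' : e.hom ≫ (𝒞.pull f).map q.hom = p.hom ≫ (𝒞.pull h).map c.hom ≫
        (cartPull (rfl : h ≫ k = _) _).inv ≫ (cartPull w _).hom := by
      rw [← cartComp_hom w, ← he]
      simp [cartComp]
    ext ψ
    simp [res, reassoc_of% he', reassoc_of% cartPull_naturality w,
      reassoc_of% cartPull_inv_naturality (rfl : h ≫ k = _)]
  have b₁ : Function.Bijective (fun ψ => q.hom ≫ ψ ≫ d.inv) :=
    ⟨fun a b h => by simpa using h, fun b => ⟨q.inv ≫ b ≫ d.hom, by simp⟩⟩
  rw [← Function.Bijective.of_comp_iff _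
    (b₁.comp ((Functor.FullyFaithful.ofFullyFaithful (𝒞.pull g)).map_bijective P ((𝒞.pull g).objPreimage R))), key]
  refine Function.Bijective.comp ⟨fun a b h => (cancel_mono _).1 ((cancel_epi t.hom).1 h),
    fun b => ⟨t.inv ≫ b ≫
    (𝒞.pull f).map d.hom ≫ (cartPull w _).inv ≫ (cartPull (rfl : h ≫ k = _) _).hom, by
      simp [← Functor.map_comp]⟩⟩
    (((Functor.FullyFaithful.ofFullyFaithful (𝒞.pull h)).map_bijective _ _).comp (hu _))

end

/-- Pasting of squares: restrict the cell from k' to k, then from k to f. The work lies in choosing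
intermediate pullbacks compatibly with the given ones. -/
theorem PreservesOpcart.vcomp {A B C D C' D' : S} {f : A ⟶ B}
    {h : A ⟶ C} {g : B ⟶ D} {k : C ⟶ D} {w : f ≫ g = h ≫ k}
    {h' : C ⟶ C'} {g' : D ⟶ D'} {k' : C' ⟶ D'} {w' : k ≫ g' = h' ≫ k'}
    (H : 𝒞.PreservesOpcart w) (H' : 𝒞.PreservesOpcart w') {h'' : A ⟶ C'} {g'' : B ⟶ D'}
    (w'' : f ≫ g'' = h'' ≫ k') (hh : h ≫ h' = h'') (hg : g ≫ g' = g'') :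
    𝒞.PreservesOpcart w'' := by
  subst hh hg
  constructor
  intro T P' P c u hu T' P'' Q t p q e he
  obtain ⟨t₁, rfl⟩ := exists_cartComp_eq (w := rfl) (Iso.refl _) t
  obtain ⟨p₁, rfl⟩ := exists_cartComp_eq (w := rfl) (Iso.refl _) p
  obtain ⟨q₁, rfl⟩ := exists_cartComp_eq (w := rfl) (Iso.refl _) q
  obtain ⟨e₁, he₁⟩ := exists_cartComp_eq (w := w')
    (Iso.refl ((𝒞.pull g').obj P)) (cartComp rfl (Iso.refl _) c)
  have H₁ := H'.opcart_res c u hu (Iso.refl _) (Iso.refl _) (Iso.refl _) e₁ he₁.symm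
  rw [← res_res]
  have w₃ : (h ≫ k) ≫ g' = (h ≫ h') ≫ k' := by rw [Category.assoc, w', Category.assoc]
  refine H.opcart_res _ _ H₁ _ _ q₁ e (cartComp_right_injective (c := Iso.refl _) w₃ ?_)
  rw [cartComp_assoc (w₁ := (Category.assoc h h' k').symm) (w₂ := w'), he₁,
    cartComp_assoc (w₁ := w'') (w₂ := rfl), ← he, cartComp_assoc]

end

end IndexedSymMonCat

/-! ### Beck-Chevalley and the projection formula in terms of opcartesian cells. -/

namespace IndexedSymMonCat

namespace IndexedHomotopyCoproducts

variable {S : Type u} [Category.{v} S] [CartesianMonoidalCategory S]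
  {𝒞 : IndexedSymMonCat.{u, v, u', v'} S} (K : 𝒞.IndexedHomotopyCoproducts)

/-- The universal cell `T ⟶ f^* f_! T`. -/
def pushUnit {X Y : S} (f : X ⟶ Y) (T : 𝒞.Fib X) : T ⟶ (𝒞.pull f).obj ((K.push f).obj T) :=
  (K.adj f).unit.app T

theorem pushUnit_naturality {X Y : S} (f : X ⟶ Y) {T T' : 𝒞.Fib X} (φ : T ⟶ T') :
    φ ≫ K.pushUnit f T' = K.pushUnit f T ≫ (𝒞.pull f).map ((K.push f).map φ) :=
  (K.adj f).unit.naturality φ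

theorem opcart_pushUnit {X Y : S} (f : X ⟶ Y) (T : 𝒞.Fib X) :
    Opcart (Iso.refl _) (K.pushUnit f T) := by
  intro R
  have : (fun φ : (K.push f).obj T ⟶ R =>
      K.pushUnit f T ≫ (Iso.refl _ : _ ≅ (𝒞.pull f).obj ((K.push f).obj T)).hom ≫
        (𝒞.pull f).map φ) = (K.adj f).homEquiv T R := by
    funext φ
    simp [Adjunction.homEquiv_unit, pushUnit]
  rw [this]
  exact ((K.adj f).homEquiv T R).bijective

/-- The map assumed invertible is the adjoint transpose f_! T → P, and composing the universal cell
with an isomorphism keeps it opcartesian. -/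
theorem opcart_of_isIso {X Y : S} {f : X ⟶ Y} {T P' : 𝒞.Fib X} {P : 𝒞.Fib Y}
    {c : P' ≅ (𝒞.pull f).obj P} {u : T ⟶ P'}
    (h : IsIso ((K.push f).map (u ≫ c.hom) ≫ (K.adj f).counit.app P)) : Opcart c u := by
  have := (K.opcart_pushUnit f T).postcomp_iso c
    ((K.push f).map (u ≫ c.hom) ≫ (K.adj f).counit.app P)
  convert this using 1
  rw [← cancel_mono c.hom]
  simp [res, pushUnit]

-- The Beck-Chevalley morphism is the adjoint transpose of the restricted universal cell, which is
-- `key` below.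
include K in
theorem preservesOpcart {A B C D : S} {f : A ⟶ B} {h : A ⟶ C} {g : B ⟶ D} {k : C ⟶ D}
    (w : f ≫ g = h ≫ k) (hb : BasicHomotopyPullback f h g k) : 𝒞.PreservesOpcart w := by
  apply PreservesOpcart.of_exists w
  intro T
  obtain ⟨e, he⟩ := exists_cartComp_eq (w := w) (Iso.refl ((𝒞.pull g).obj ((K.push k).obj T)))
    (cartComp rfl (Iso.refl ((𝒞.pull h).obj ((𝒞.pull k).obj ((K.push k).obj T)))) (Iso.refl _))
  refine ⟨_, _, _, _, K.opcart_pushUnit k T, _, _, _, Iso.refl _, Iso.refl _, Iso.refl _, e, he.symm,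
    K.opcart_of_isIso ?_⟩
  have he' : e.hom = (cartPull (rfl : h ≫ k = h ≫ k) _).inv ≫ (cartPull w _).hom := by
    have := cartComp_hom w e (Iso.refl _)
    rw [he] at this
    simpa [cartComp] using this.symm
  have key : 𝒞.beckChevalley K.push K.adj w T =
      (K.push f).map (res (Iso.refl _) (Iso.refl _) (K.pushUnit k T) ≫ e.hom) ≫
        (K.adj f).counit.app _ := by
    rw [he']
    simp [beckChevalley, res, pushUnit, cartPull, pullFac]
  exact key ▸ K.beckChevalley_isIso w hb T

variable {K}

/-- For the universal cell T → f^* f_! T the adjoint transpose of the whiskered cell is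
`projectionMap`; any other opcartesian cell differs from it by an isomorphism. -/
theorem PreservedByTensor.opcart_whiskerLeft (hK : K.PreservedByTensor) {X Y : S} {f : X ⟶ Y} {T P' : 𝒞.Fib X} {P : 𝒞.Fib Y}
    {c : P' ≅ (𝒞.pull f).obj P} {u : T ⟶ P'} (hu : Opcart c u) {Q' : 𝒞.Fib X} {Q : 𝒞.Fib Y}
    (s : Q' ≅ (𝒞.pull f).obj Q) : Opcart (cartTensor s c) (Q' ◁ u) := by
  have h₀ : Opcart (cartTensor s (Iso.refl _)) (Q' ◁ K.pushUnit f T) := by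
    have := hK f Q T
    have h₁ : Opcart (Iso.refl _) ((𝒞.pull f).obj Q ◁ K.pushUnit f T ≫
        Functor.LaxMonoidal.μ (𝒞.pull f) Q ((K.push f).obj T)) :=
      K.opcart_of_isIso (by simpa [projectionMap, pushUnit] using this)
    rw [Opcart.iff_refl]
    convert h₁.precomp_iso (s.hom ▷ T) using 1
    simp [cartTensor, ← whisker_exchange_assoc]
  obtain ⟨e, rfl⟩ := (K.opcart_pushUnit f T).exists_iso hu
  rw [MonoidalCategory.whiskerLeft_comp, ← res_whiskerLeft]
  exact h₀.postcomp_iso _ _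

theorem PreservedByTensor.opcart_whiskerRight (hK : K.PreservedByTensor) {X Y : S} {f : X ⟶ Y} {T P' : 𝒞.Fib X}
    {P : 𝒞.Fib Y} {c : P' ≅ (𝒞.pull f).obj P} {u : T ⟶ P'} (hu : Opcart c u) {Q' : 𝒞.Fib X}
    {Q : 𝒞.Fib Y} (s : Q' ≅ (𝒞.pull f).obj Q) : Opcart (cartTensor c s) (u ▷ Q') := by
  have := ((hK.opcart_whiskerLeft hu s).postcomp_iso (cartTensor c s) (β_ Q P).hom).precomp_iso
    (β_ T Q').hom
  rw [res_braiding_hom] at this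
  simpa using this

end IndexedHomotopyCoproducts

end IndexedSymMonCat

/-! ### Generalized elements and the cells of composites, units and shadows. -/

namespace IndexedSymMonCat

section

variable {S : Type u} [Category.{v} S] {𝒞 : IndexedSymMonCat.{u, v, u', v'} S}

theorem cartComp_cartPull_refl {A B C B' : S} {h : A ⟶ B} {g : B ⟶ C} {h' : A ⟶ B'} {g' : B' ⟶ C}
    {k k' : A ⟶ C} (w₁ : h ≫ g = k) (w₁' : h ≫ g = k') (w₂ : h' ≫ g' = k) (w₂' : h' ≫ g' = k')
    (M : 𝒞.Fib C) :
    cartComp w₁' (cartPull w₁ M) (Iso.refl _) = cartComp w₂' (cartPull w₂ M) (Iso.refl _) := by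
  subst w₁ w₁'
  ext
  simp [cartComp]

theorem cartComp_cartPull_refl_self {A B C : S} {h : A ⟶ B} {g : B ⟶ C}
    {k : A ⟶ C} (w : h ≫ g = k) (M : 𝒞.Fib C) :
    cartComp w (cartPull w M) (Iso.refl _) = Iso.refl _ := by
  ext
  simp [cartComp]

end

variable {S : Type u} [Category.{v} S] [CartesianMonoidalCategory S]
  {𝒞 : IndexedSymMonCat.{u, v, u', v'} S}

section ev

variable {A B Z Z' : S}

/-- The value `M(a, b)` of `M` at generalized elements `a` and `b`. -/
abbrev ev (M : 𝒞.Fib (A ⊗ B)) (a : Z ⟶ A) (b : Z ⟶ B) : 𝒞.Fib Z :=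
  (𝒞.pull (lift a b)).obj M

/-- The value of a morphism at generalized elements. -/
def evMap {M N : 𝒞.Fib (A ⊗ B)} (φ : M ⟶ N) (a : Z ⟶ A) (b : Z ⟶ B) : ev M a b ⟶ ev N a b :=
  (𝒞.pull (lift a b)).map φ

theorem evMap_id (M : 𝒞.Fib (A ⊗ B)) (a : Z ⟶ A) (b : Z ⟶ B) : evMap (𝟙 M) a b = 𝟙 _ :=
  (𝒞.pull (lift a b)).map_id M

theorem evMap_comp {M N P : 𝒞.Fib (A ⊗ B)} (φ : M ⟶ N) (ψ : N ⟶ P) (a : Z ⟶ A) (b : Z ⟶ B) :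
    evMap (φ ≫ ψ) a b = evMap φ a b ≫ evMap ψ a b :=
  (𝒞.pull (lift a b)).map_comp φ ψ

/-- The comparison `M(a', b') ≅ g^* M(a, b)` for `a' = g ≫ a`, `b' = g ≫ b`. -/
def evCart (M : 𝒞.Fib (A ⊗ B)) {g : Z' ⟶ Z} {a : Z ⟶ A} {b : Z ⟶ B} {a' : Z' ⟶ A} {b' : Z' ⟶ B}
    (ha : g ≫ a = a') (hb : g ≫ b = b') : ev M a' b' ≅ (𝒞.pull g).obj (ev M a b) :=
  cartPull (by rw [comp_lift, ha, hb]) M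

variable {g : Z' ⟶ Z} {a : Z ⟶ A} {b : Z ⟶ B} {a' : Z' ⟶ A} {b' : Z' ⟶ B}
  (ha : g ≫ a = a') (hb : g ≫ b = b')

theorem res_evMap {M N : 𝒞.Fib (A ⊗ B)} (φ : M ⟶ N) :
    res (evCart M ha hb) (evCart N ha hb) (evMap φ a b) = evMap φ a' b' :=
  res_cartPull _ φ

/-- The value of an object over the terminal object. -/
abbrev evUnit (Z : S) (M : 𝒞.Fib (𝟙_ S)) : 𝒞.Fib Z :=
  (𝒞.pull (toUnit Z)).obj M

/-- The value of a morphism over the terminal object. -/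
def evUnitMap (Z : S) {M N : 𝒞.Fib (𝟙_ S)} (φ : M ⟶ N) : evUnit Z M ⟶ evUnit Z N :=
  (𝒞.pull (toUnit Z)).map φ

theorem evUnitMap_id (Z : S) (M : 𝒞.Fib (𝟙_ S)) : evUnitMap Z (𝟙 M) = 𝟙 _ :=
  (𝒞.pull (toUnit Z)).map_id M

theorem evUnitMap_comp (Z : S) {M N P : 𝒞.Fib (𝟙_ S)} (φ : M ⟶ N) (ψ : N ⟶ P) :
    evUnitMap Z (φ ≫ ψ) = evUnitMap Z φ ≫ evUnitMap Z ψ :=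
  (𝒞.pull (toUnit Z)).map_comp φ ψ

/-- The comparison of values of an object over the terminal object. -/
def evUnitCart (M : 𝒞.Fib (𝟙_ S)) (g : Z' ⟶ Z) : evUnit Z' M ≅ (𝒞.pull g).obj (evUnit Z M) :=
  cartPull (comp_toUnit g) M

theorem res_evUnitMap {M N : 𝒞.Fib (𝟙_ S)} (φ : M ⟶ N) :
    res (evUnitCart M g) (evUnitCart N g) (evUnitMap Z φ) = evUnitMap Z' φ :=
  res_cartPull _ φ

end ev

namespace IndexedHomotopyCoproducts

variable (K : 𝒞.IndexedHomotopyCoproducts)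

/-- The composite `M ⊙ N`. -/
abbrev odot {A B C : S} (M : 𝒞.Fib (A ⊗ B)) (N : 𝒞.Fib (B ⊗ C)) : 𝒞.Fib (A ⊗ C) :=
  ((K.composition A B C).obj M).obj N

/-- Whiskering `M ⊙ N ⟶ M ⊙ N'`. -/
abbrev odotLeft {A B C : S} (M : 𝒞.Fib (A ⊗ B)) {N N' : 𝒞.Fib (B ⊗ C)} (ψ : N ⟶ N') :
    K.odot M N ⟶ K.odot M N' :=
  ((K.composition A B C).obj M).map ψ

/-- Whiskering `M ⊙ N ⟶ M' ⊙ N`. -/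
abbrev odotRight {A B C : S} {M M' : 𝒞.Fib (A ⊗ B)} (φ : M ⟶ M') (N : 𝒞.Fib (B ⊗ C)) :
    K.odot M N ⟶ K.odot M' N :=
  ((K.composition A B C).map φ).app N

section cells

variable {A B C Z Z' : S} (M M' : 𝒞.Fib (A ⊗ B)) (N N' : 𝒞.Fib (B ⊗ C))

/-- `M(a, b) ⊗ N(b, c)` at the universal elements, as a pullback of the external product. -/
def middleIso : ev M (fst A (B ⊗ C)) (snd A (B ⊗ C) ≫ fst B C) ⊗
    ev N (snd A (B ⊗ C) ≫ fst B C) (snd A (B ⊗ C) ≫ snd B C) ≅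
      (𝒞.pull (middleDiagonal A B C)).obj
        ((𝒞.pull (fst _ _)).obj M ⊗ (𝒞.pull (snd _ _)).obj N) :=
  cartTensor (cartPull (by ext <;> simp [middleDiagonal]) M)
    (cartPull (by ext <;> simp [middleDiagonal]) N)

/-- The universal cell of the composite `M ⊙ N`. -/
def compCellAux : ev M (fst A (B ⊗ C)) (snd A (B ⊗ C) ≫ fst B C) ⊗
    ev N (snd A (B ⊗ C) ≫ fst B C) (snd A (B ⊗ C) ≫ snd B C) ⟶
      (𝒞.pull (middleProjection A B C)).obj (K.odot M N) :=
  (middleIso M N).hom ≫ K.pushUnit (middleProjection A B C) _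

theorem opcart_compCellAux : Opcart (Iso.refl _) (K.compCellAux M N) :=
  (K.opcart_pushUnit _ _).precomp_iso (middleIso M N).hom

theorem lift_middleProjection (a : Z ⟶ A) (b : Z ⟶ B) (c : Z ⟶ C) :
    lift a (lift b c) ≫ middleProjection A B C = lift a c := by
  ext <;> simp [middleProjection]

/-- `M(a, b) ⊗ N(b, c)` as a pullback of its value at the universal elements. -/
def compCart (a : Z ⟶ A) (b : Z ⟶ B) (c : Z ⟶ C) : ev M a b ⊗ ev N b c ≅
    (𝒞.pull (lift a (lift b c))).obj (ev M (fst A (B ⊗ C)) (snd A (B ⊗ C) ≫ fst B C) ⊗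
      ev N (snd A (B ⊗ C) ≫ fst B C) (snd A (B ⊗ C) ≫ snd B C)) :=
  cartTensor (evCart M (by simp) (by simp)) (evCart N (by simp) (by simp))

/-- The cell `M(a, b) ⊗ N(b, c) ⟶ (M ⊙ N)(a, c)`. -/
def compCell (a : Z ⟶ A) (b : Z ⟶ B) (c : Z ⟶ C) : ev M a b ⊗ ev N b c ⟶ ev (K.odot M N) a c :=
  res (compCart M N a b c) (cartPull (lift_middleProjection a b c) _)
    (K.compCellAux M N)

/-- Cells are stable under substitution, so an identity proved in a universal context holds at all
generalized elements. -/
theorem res_compCell {g : Z' ⟶ Z} {a : Z ⟶ A} {b : Z ⟶ B} {c : Z ⟶ C} {a' : Z' ⟶ A} {b' : Z' ⟶ B}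
    {c' : Z' ⟶ C} (ha : g ≫ a = a') (hb : g ≫ b = b') (hc : g ≫ c = c') :
    res (cartTensor (evCart M ha hb) (evCart N hb hc)) (evCart _ ha hc) (K.compCell M N a b c) =
      K.compCell M N a' b' c' := by
  have w : g ≫ lift a (lift b c) = lift a' (lift b' c') := by simp [comp_lift, ha, hb, hc]
  unfold compCell compCart
  rw [res_res w, cartComp_cartTensor]
  simp only [evCart]
  rw [cartComp_cartPull, cartComp_cartPull, cartComp_cartPull]

variable {M M'} in
theorem compCell_evMap_right (φ : M ⟶ M') (a : Z ⟶ A) (b : Z ⟶ B) (c : Z ⟶ C) :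
    K.compCell M N a b c ≫ evMap (K.odotRight φ N) a c =
      evMap φ a b ▷ _ ≫ K.compCell M' N a b c := by
  have h₁ : (middleIso M N).hom ≫ (𝒞.pull (middleDiagonal A B C)).map
      ((𝒞.pull (fst _ _)).map φ ▷ (𝒞.pull (snd _ _)).obj N) =
        evMap φ _ _ ▷ _ ≫ (middleIso M' N).hom := by
    rw [← Iso.comp_inv_eq, Category.assoc]
    exact (res_whiskerRight _ _ _ _).trans (congrArg (· ▷ _) (res_cartPull _ _))
  have h₂ : K.compCellAux M N ≫ (𝒞.pull _).map (K.odotRight φ N) =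
      evMap φ (fst A (B ⊗ C)) (snd A (B ⊗ C) ≫ fst B C) ▷ _ ≫ K.compCellAux M' N :=
    calc
      _ = (middleIso M N).hom ≫ K.pushUnit (middleProjection A B C) _ ≫ (𝒞.pull _).map
          ((K.push _).map ((𝒞.pull (middleDiagonal A B C)).map
            ((𝒞.pull (fst _ _)).map φ ▷ (𝒞.pull (snd _ _)).obj N))) := Category.assoc _ _ _
      _ = (middleIso M N).hom ≫ (𝒞.pull (middleDiagonal A B C)).map
          ((𝒞.pull (fst _ _)).map φ ▷ (𝒞.pull (snd _ _)).obj N) ≫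
            K.pushUnit (middleProjection A B C) _ := by rw [pushUnit_naturality]
      _ = _ := (Category.assoc _ _ _).symm.trans ((congrArg (· ≫ K.pushUnit _ _) h₁).trans
          (Category.assoc _ _ _))
  have h₃ : res (compCart M N a b c) (compCart M' N a b c)
      (evMap φ (fst A (B ⊗ C)) (snd A (B ⊗ C) ≫ fst B C) ▷ _) = evMap φ a b ▷ _ :=
    (res_whiskerRight _ _ _ _).trans (congrArg (· ▷ _) (res_evMap _ _ _))
  unfold compCell evMap
  rw [← res_cartPull (lift_middleProjection a b c), ← res_comp, h₂,
    res_comp _ (compCart M' N a b c), h₃]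
  rfl

variable {N N'} in
theorem compCell_evMap_left (φ : N ⟶ N') (a : Z ⟶ A) (b : Z ⟶ B) (c : Z ⟶ C) :
    K.compCell M N a b c ≫ evMap (K.odotLeft M φ) a c =
      _ ◁ evMap φ b c ≫ K.compCell M N' a b c := by
  have h₁ : (middleIso M N).hom ≫ (𝒞.pull (middleDiagonal A B C)).map
      ((𝒞.pull (fst _ _)).obj M ◁ (𝒞.pull (snd _ _)).map φ) =
        _ ◁ evMap φ _ _ ≫ (middleIso M N').hom := by
    rw [← Iso.comp_inv_eq, Category.assoc]
    exact (res_whiskerLeft _ _ _ _).trans (congrArg (_ ◁ ·) (res_cartPull _ _))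
  have h₂ : K.compCellAux M N ≫ (𝒞.pull _).map (K.odotLeft M φ) =
      _ ◁ evMap φ (snd A (B ⊗ C) ≫ fst B C) (snd A (B ⊗ C) ≫ snd B C) ≫ K.compCellAux M N' :=
    calc
      _ = (middleIso M N).hom ≫ K.pushUnit (middleProjection A B C) _ ≫ (𝒞.pull _).map
          ((K.push _).map ((𝒞.pull (middleDiagonal A B C)).map
            ((𝒞.pull (fst _ _)).obj M ◁ (𝒞.pull (snd _ _)).map φ))) := Category.assoc _ _ _
      _ = (middleIso M N).hom ≫ (𝒞.pull (middleDiagonal A B C)).map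
          ((𝒞.pull (fst _ _)).obj M ◁ (𝒞.pull (snd _ _)).map φ) ≫
            K.pushUnit (middleProjection A B C) _ := by rw [pushUnit_naturality]
      _ = _ := (Category.assoc _ _ _).symm.trans ((congrArg (· ≫ K.pushUnit _ _) h₁).trans
          (Category.assoc _ _ _))
  have h₃ : res (compCart M N a b c) (compCart M N' a b c)
      (_ ◁ evMap φ (snd A (B ⊗ C) ≫ fst B C) (snd A (B ⊗ C) ≫ snd B C)) = _ ◁ evMap φ b c :=
    (res_whiskerLeft _ _ _ _).trans (congrArg (_ ◁ ·) (res_evMap _ _ _))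
  unfold compCell evMap
  rw [← res_cartPull (lift_middleProjection a b c), ← res_comp, h₂,
    res_comp _ (compCart M N' a b c), h₃]
  rfl

/-- The universal cell of the unit. -/
def unitCellAux (A : S) :
    𝟙_ (𝒞.Fib A) ⟶ (𝒞.pull (lift (𝟙 A) (𝟙 A))).obj (K.unitCell A) :=
  (cartUnit (toUnit A)).hom ≫ K.pushUnit (lift (𝟙 A) (𝟙 A)) _

theorem opcart_unitCellAux (A : S) : Opcart (Iso.refl _) (K.unitCellAux A) :=
  (K.opcart_pushUnit _ _).precomp_iso _

/-- The cell `𝟙 ⟶ U_A(a, a)`. -/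
def idCell (a : Z ⟶ A) : 𝟙_ (𝒞.Fib Z) ⟶ ev (K.unitCell A) a a :=
  res (cartUnit a) (cartPull (by simp [comp_lift]) _) (K.unitCellAux A)

theorem res_idCell {g : Z' ⟶ Z} {a : Z ⟶ A} {a' : Z' ⟶ A} (ha : g ≫ a = a') :
    res (cartUnit g) (evCart _ ha ha) (K.idCell a) = K.idCell a' := by
  unfold idCell
  rw [res_res ha, cartComp_cartUnit]
  simp only [evCart]
  rw [cartComp_cartPull]

/-- The universal cell of the shadow. -/
def shadowCellAux (M : 𝒞.Fib (A ⊗ A)) :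
    ev M (𝟙 A) (𝟙 A) ⟶ evUnit A ((K.shadowFunctor A).obj M) :=
  K.pushUnit (toUnit A) _

theorem opcart_shadowCellAux (M : 𝒞.Fib (A ⊗ A)) :
    Opcart (f := toUnit A) (Iso.refl _) (K.shadowCellAux M) :=
  K.opcart_pushUnit _ _

/-- The cell `M(a, a) ⟶ ⟨M⟩`. -/
def shadowCell (M : 𝒞.Fib (A ⊗ A)) (a : Z ⟶ A) :
    ev M a a ⟶ evUnit Z ((K.shadowFunctor A).obj M) :=
  res (evCart M (by simp) (by simp)) (evUnitCart _ a) (K.shadowCellAux M)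

theorem res_shadowCell (M : 𝒞.Fib (A ⊗ A)) {g : Z' ⟶ Z} {a : Z ⟶ A} {a' : Z' ⟶ A}
    (ha : g ≫ a = a') :
    res (evCart _ ha ha) (evUnitCart _ g) (K.shadowCell M a) = K.shadowCell M a' := by
  unfold shadowCell
  rw [res_res ha]
  simp only [evCart, evUnitCart]
  rw [cartComp_cartPull, cartComp_cartPull]

theorem shadowCell_evUnitMap {M M' : 𝒞.Fib (A ⊗ A)} (φ : M ⟶ M') (a : Z ⟶ A) :
    K.shadowCell M a ≫ evUnitMap Z ((K.shadowFunctor A).map φ) =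
      evMap φ a a ≫ K.shadowCell M' a := by
  have h : K.shadowCellAux M ≫ (𝒞.pull _).map ((K.shadowFunctor A).map φ) =
      evMap φ _ _ ≫ K.shadowCellAux M' :=
    (K.pushUnit_naturality _ _).symm
  unfold shadowCell
  rw [← res_evUnitMap (g := a), ← res_comp, evUnitMap, h,
    res_comp _ (evCart M' (Category.comp_id a) (Category.comp_id a)), res_evMap]

end cells

section opcart

-- Invertibility of `lift g b` identifies g with the projection W × B → W. Up to isomorphisms at
-- both ends (`w₁`, `w₃`), the square is the reindexing square of (a, c) against B → 1.
include K in
theorem preservesOpcart_middleProjection {A B C Z W : S} (g : Z ⟶ W) (b : Z ⟶ B)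
    [IsIso (lift g b)] (a : W ⟶ A) (c : W ⟶ C) :
    𝒞.PreservesOpcart (f := g) (h := lift (g ≫ a) (lift b (g ≫ c))) (g := lift a c)
      (k := middleProjection A B C) (by rw [lift_middleProjection, comp_lift]) := by
  have w₁ : g ≫ (ρ_ W).inv = lift g b ≫ W ◁ toUnit B := by ext; simp
  have w₂ : W ◁ toUnit B ≫ lift a c ▷ 𝟙_ S = lift a c ▷ B ≫ (A ⊗ C) ◁ toUnit B := whisker_exchange _ _
  have w₃ : (A ⊗ C) ◁ toUnit B ≫ (ρ_ (A ⊗ C)).hom =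
      lift (fst (A ⊗ C) B ≫ fst A C) (lift (snd (A ⊗ C) B) (fst (A ⊗ C) B ≫ snd A C)) ≫
        middleProjection A B C := by
    rw [lift_middleProjection]; rw [whiskerLeft_toUnit_comp_rightUnitor_hom]; ext <;> simp
  have : IsIso (lift (fst (A ⊗ C) B ≫ fst A C)
      (lift (snd (A ⊗ C) B) (fst (A ⊗ C) B ≫ snd A C))) :=
    ⟨lift (lift (fst _ _) (snd _ _ ≫ snd _ _)) (snd _ _ ≫ fst _ _), by ext <;> simp,
      by ext <;> simp⟩
  have h₁ : 𝒞.PreservesOpcart w₁ := .of_isIso w₁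
  have h₂ : 𝒞.PreservesOpcart w₂ := K.preservesOpcart w₂ (.transpose (.reindexing _ _))
  have h₃ : 𝒞.PreservesOpcart w₃ := .of_isIso w₃
  exact h₁.vcomp (h₂.vcomp h₃ (by rw [reassoc_of% w₂, w₃, Category.assoc]) rfl rfl) _
    (by ext <;> simp) (by ext <;> simp)

-- The two invertibility assumptions identify d with Δ_A × Q. The square is then, up to
-- isomorphisms, the reindexing square of Δ_A against Q → 1.
include K in
theorem preservesOpcart_diagonal {A Q W V : S} {d : W ⟶ V} {a : W ⟶ A} {x y : V ⟶ A}
    (hx : d ≫ x = a) (hy : d ≫ y = a) {q : W ⟶ Q} {r : V ⟶ Q} (hr : d ≫ r = q)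
    [IsIso (lift a q)] [IsIso (lift (lift x y) r)] :
    𝒞.PreservesOpcart (f := d) (h := a) (g := lift x y) (k := lift (𝟙 A) (𝟙 A))
      (by ext <;> simp [hx, hy]) := by
  have w₁ : d ≫ lift (lift x y) r = lift a q ≫ lift (𝟙 A) (𝟙 A) ▷ Q := by
    ext <;> simp [hx, hy, hr]
  have w₂ : lift (𝟙 A) (𝟙 A) ▷ Q ≫ (A ⊗ A) ◁ toUnit Q =
      A ◁ toUnit Q ≫ lift (𝟙 A) (𝟙 A) ▷ 𝟙_ S := (whisker_exchange _ _).symm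
  have w₃ : lift (𝟙 A) (𝟙 A) ▷ 𝟙_ S ≫ (ρ_ (A ⊗ A)).hom = (ρ_ A).hom ≫ lift (𝟙 A) (𝟙 A) := by
    simp
  have h₁ : 𝒞.PreservesOpcart w₁ := .of_isIso w₁
  have h₂ : 𝒞.PreservesOpcart w₂ := K.preservesOpcart w₂ (.reindexing _ _)
  have h₃ : 𝒞.PreservesOpcart w₃ := .of_isIso w₃
  exact h₁.vcomp (h₂.vcomp h₃ (by rw [reassoc_of% w₂, w₃, Category.assoc]) rfl rfl) _
    (by simp [whiskerLeft_toUnit_comp_rightUnitor_hom])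
    (by rw [whiskerLeft_toUnit_comp_rightUnitor_hom]; simp)

theorem opcart_compCell {A B C Z W : S} (M : 𝒞.Fib (A ⊗ B)) (N : 𝒞.Fib (B ⊗ C)) {g : Z ⟶ W}
    {b : Z ⟶ B} [IsIso (lift g b)] {a : W ⟶ A} {c : W ⟶ C} {a' : Z ⟶ A} {c' : Z ⟶ C}
    (ha : g ≫ a = a') (hc : g ≫ c = c') :
    Opcart (evCart (K.odot M N) ha hc) (K.compCell M N a' b c') := by
  subst ha hc
  exact (K.preservesOpcart_middleProjection g b a c).opcart_res _ _ (K.opcart_compCellAux M N) _ _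
    (Iso.refl _) _ (cartComp_cartPull_refl _ _ _ _ _)

theorem opcart_idCell {A Q W V : S} {d : W ⟶ V} {a : W ⟶ A} {x y : V ⟶ A}
    (hx : d ≫ x = a) (hy : d ≫ y = a) {q : W ⟶ Q} {r : V ⟶ Q} (hr : d ≫ r = q)
    [IsIso (lift a q)] [IsIso (lift (lift x y) r)] :
    Opcart (evCart (K.unitCell A) hx hy) (K.idCell a) :=
  (K.preservesOpcart_diagonal hx hy hr).opcart_res _ _ (K.opcart_unitCellAux A) _ _
    (Iso.refl _) _ (cartComp_cartPull_refl _ _ _ _ _)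

end opcart

end IndexedHomotopyCoproducts

end IndexedSymMonCat

namespace IndexedSymMonCat

namespace IndexedHomotopyCoproducts

variable {S : Type u} [Category.{v} S] [CartesianMonoidalCategory S]
  {𝒞 : IndexedSymMonCat.{u, v, u', v'} S} {K : 𝒞.IndexedHomotopyCoproducts}

instance isIso_lift_fst_snd (A B : S) : IsIso (lift (fst A B) (snd A B)) := by
  rw [lift_fst_snd]; infer_instance

instance isIso_lift_snd_fst (A B : S) : IsIso (lift (snd A B) (fst A B)) :=
  ⟨lift (snd _ _) (fst _ _), by ext <;> simp, by ext <;> simp⟩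

/-! ### Testing equalities of morphisms on cells. -/

section ext

/-- Morphisms agree if their values at the universal elements agree. -/
theorem evMap_ext {A B : S} {M N : 𝒞.Fib (A ⊗ B)} {φ ψ : M ⟶ N}
    (h : evMap φ (fst A B) (snd A B) = evMap ψ (fst A B) (snd A B)) : φ = ψ := by
  have := isEquivalence_pull (𝒞 := 𝒞) (lift (fst A B) (snd A B))
  exact (𝒞.pull (lift (fst A B) (snd A B))).map_injective h

variable {A B C D E : S} {M : 𝒞.Fib (A ⊗ B)} {N : 𝒞.Fib (B ⊗ C)} {P : 𝒞.Fib (C ⊗ D)}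
  {Q : 𝒞.Fib (D ⊗ E)}

theorem compCell_hom_ext {W : S} {a : W ⟶ A} {c : W ⟶ C} {R : 𝒞.Fib W} {R' : 𝒞.Fib (W ⊗ B)}
    (r : R' ≅ (𝒞.pull (fst W B)).obj R) {φ ψ : ev (K.odot M N) a c ⟶ R}
    (h : K.compCell M N (fst W B ≫ a) (snd W B) (fst W B ≫ c) ≫ res (evCart _ rfl rfl) r φ =
      K.compCell M N (fst W B ≫ a) (snd W B) (fst W B ≫ c) ≫ res (evCart _ rfl rfl) r ψ) :
    φ = ψ :=
  (K.opcart_compCell M N rfl rfl).hom_ext r h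

theorem PreservedByTensor.compCell_whiskerRight_hom_ext (hK : K.PreservedByTensor) {W : S}
    {a : W ⟶ A} {c : W ⟶ C} {T R : 𝒞.Fib W} {T' R' : 𝒞.Fib (W ⊗ B)}
    (t : T' ≅ (𝒞.pull (fst W B)).obj T)
    (r : R' ≅ (𝒞.pull (fst W B)).obj R) {φ ψ : ev (K.odot M N) a c ⊗ T ⟶ R}
    (h : K.compCell M N (fst W B ≫ a) (snd W B) (fst W B ≫ c) ▷ T' ≫
        res (cartTensor (evCart _ rfl rfl) t) r φ =
      K.compCell M N (fst W B ≫ a) (snd W B) (fst W B ≫ c) ▷ T' ≫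
        res (cartTensor (evCart _ rfl rfl) t) r ψ) :
    φ = ψ :=
  (hK.opcart_whiskerRight (K.opcart_compCell M N rfl rfl) t).hom_ext r h

theorem hom_ext₂ {R : 𝒞.Fib (A ⊗ C)} {φ ψ : K.odot M N ⟶ R}
    (h : ∀ {Z : S} (a : Z ⟶ A) (b : Z ⟶ B) (c : Z ⟶ C),
      K.compCell M N a b c ≫ evMap φ a c = K.compCell M N a b c ≫ evMap ψ a c) : φ = ψ := by
  refine evMap_ext (compCell_hom_ext (evCart R rfl rfl) ?_)
  rw [res_evMap, res_evMap]
  exact h _ _ _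

theorem PreservedByTensor.hom_ext₃ (hK : K.PreservedByTensor) {R : 𝒞.Fib (A ⊗ D)}
    {φ ψ : K.odot (K.odot M N) P ⟶ R}
    (h : ∀ {Z : S} (a : Z ⟶ A) (b : Z ⟶ B) (c : Z ⟶ C) (d : Z ⟶ D),
      K.compCell M N a b c ▷ _ ≫ K.compCell _ P a c d ≫ evMap φ a d =
        K.compCell M N a b c ▷ _ ≫ K.compCell _ P a c d ≫ evMap ψ a d) : φ = ψ := by
  refine hom_ext₂ fun a c d => ?_
  refine hK.compCell_whiskerRight_hom_ext (evCart P rfl rfl) (evCart R rfl rfl) ?_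
  rw [res_comp _ (evCart _ rfl rfl), res_comp _ (evCart _ rfl rfl), res_compCell, res_evMap,
    res_evMap]
  exact h _ _ _ _

theorem PreservedByTensor.hom_ext₄ (hK : K.PreservedByTensor) {R : 𝒞.Fib (A ⊗ E)}
    {φ ψ : K.odot (K.odot (K.odot M N) P) Q ⟶ R}
    (h : ∀ {Z : S} (a : Z ⟶ A) (b : Z ⟶ B) (c : Z ⟶ C) (d : Z ⟶ D) (e : Z ⟶ E),
      K.compCell M N a b c ▷ _ ▷ _ ≫ K.compCell _ P a c d ▷ _ ≫ K.compCell _ Q a d e ≫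
          evMap φ a e =
        K.compCell M N a b c ▷ _ ▷ _ ≫ K.compCell _ P a c d ▷ _ ≫ K.compCell _ Q a d e ≫
          evMap ψ a e) : φ = ψ := by
  refine hK.hom_ext₃ fun a c d e => ?_
  -- Reassociating makes the innermost cell whiskered by the single object P(c, d) ⊗ Q(d, e), which
  -- does not depend on b.
  rw [← cancel_epi (α_ _ _ _).inv]
  refine hK.compCell_whiskerRight_hom_ext (cartTensor (evCart P rfl rfl) (evCart Q rfl rfl))
    (evCart R rfl rfl) ?_
  have key (χ : K.odot (K.odot (K.odot M N) P) Q ⟶ R) :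
      res (cartTensor (evCart (K.odot M N) rfl rfl)
        (cartTensor (evCart P rfl rfl) (evCart Q rfl rfl))) (evCart R (g := fst _ B) rfl rfl)
        ((α_ _ _ _).inv ≫ K.compCell (K.odot M N) P a c d ▷ _ ≫ K.compCell _ Q a d e ≫
          evMap χ a e) =
      (α_ _ _ _).inv ≫ K.compCell (K.odot M N) P _ _ _ ▷ _ ≫ K.compCell _ Q _ _ _ ≫
          evMap χ _ _ := by
    rw [res_comp _ (cartTensor (cartTensor (evCart _ rfl rfl) (evCart _ rfl rfl))
        (evCart _ rfl rfl)),
      res_comp _ (cartTensor (evCart _ rfl rfl) (evCart _ rfl rfl)),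
      res_comp _ (evCart _ rfl rfl), res_associator_inv, res_whiskerRight, res_compCell,
      res_compCell, res_evMap]
  rw [key, key, ← cancel_epi (α_ _ _ _).hom]
  simpa using h _ _ _ _ _

theorem shadow_hom_ext₁ {M : 𝒞.Fib (A ⊗ A)} {R : 𝒞.Fib (𝟙_ S)}
    {φ ψ : (K.shadowFunctor A).obj M ⟶ R}
    (h : ∀ {Z : S} (a : Z ⟶ A), K.shadowCell M a ≫ evUnitMap Z φ =
      K.shadowCell M a ≫ evUnitMap Z ψ) : φ = ψ := by
  have := isEquivalence_pull (𝒞 := 𝒞) (𝟙 A)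
  refine (K.opcart_shadowCellAux M).hom_ext (R' := evUnit A R) (Iso.refl _) ?_
  -- At the identity element the cell is the universal one restricted along 𝟙, and reindexing along
  -- 𝟙 is faithful, so the restriction can be removed.
  have h₁ := h (𝟙 A)
  rw [shadowCell, ← res_evUnitMap (g := 𝟙 A) φ, ← res_evUnitMap (g := 𝟙 A) ψ, ← res_comp, ← res_comp,
    res, res] at h₁
  rw [cancel_epi, cancel_mono] at h₁
  have h₂ := (𝒞.pull (𝟙 A)).map_injective h₁
  simpa [res, evUnitMap] using h₂

theorem shadow_hom_ext₂ {M : 𝒞.Fib (A ⊗ B)} {N : 𝒞.Fib (B ⊗ A)} {R : 𝒞.Fib (𝟙_ S)}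
    {φ ψ : (K.shadowFunctor A).obj (K.odot M N) ⟶ R}
    (h : ∀ {Z : S} (a : Z ⟶ A) (b : Z ⟶ B),
      K.compCell M N a b a ≫ K.shadowCell _ a ≫ evUnitMap Z φ =
        K.compCell M N a b a ≫ K.shadowCell _ a ≫ evUnitMap Z ψ) : φ = ψ := by
  refine shadow_hom_ext₁ fun a => ?_
  refine compCell_hom_ext (evUnitCart R _) ?_
  rw [res_comp _ (evUnitCart _ _), res_comp _ (evUnitCart _ _), res_shadowCell, res_evUnitMap,
    res_evUnitMap]
  exact h _ _

theorem PreservedByTensor.shadow_hom_ext₃ (hK : K.PreservedByTensor) {M : 𝒞.Fib (A ⊗ B)}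
    {N : 𝒞.Fib (B ⊗ C)} {P : 𝒞.Fib (C ⊗ A)} {R : 𝒞.Fib (𝟙_ S)}
    {φ ψ : (K.shadowFunctor A).obj (K.odot (K.odot M N) P) ⟶ R}
    (h : ∀ {Z : S} (a : Z ⟶ A) (b : Z ⟶ B) (c : Z ⟶ C),
      K.compCell M N a b c ▷ _ ≫ K.compCell _ P a c a ≫ K.shadowCell _ a ≫ evUnitMap Z φ =
        K.compCell M N a b c ▷ _ ≫ K.compCell _ P a c a ≫ K.shadowCell _ a ≫ evUnitMap Z ψ) :
    φ = ψ := by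
  refine shadow_hom_ext₂ fun a c => ?_
  refine hK.compCell_whiskerRight_hom_ext (evCart P rfl rfl) (evUnitCart R _) ?_
  have key (χ : (K.shadowFunctor A).obj (K.odot (K.odot M N) P) ⟶ R) :
      res (cartTensor (evCart (K.odot M N) rfl rfl) (evCart P rfl rfl)) (evUnitCart R (fst _ B))
        (K.compCell _ P a c a ≫ K.shadowCell _ a ≫ evUnitMap _ χ) =
      K.compCell _ P _ _ _ ≫ K.shadowCell _ _ ≫ evUnitMap _ χ := by
    rw [res_comp _ (evCart _ rfl rfl), res_comp _ (evUnitCart _ _), res_compCell, res_shadowCell,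
      res_evUnitMap]
  rw [key, key]
  exact h _ _ _

end ext

/-! ### Existence of the constraint isomorphisms. -/

section constraints

variable {A B C D : S}

/-- Here g forgets b and h forgets c. Summing over b is compatible with tensoring by P(c, d), which
is pulled back along g; summing over c follows. -/
theorem PreservedByTensor.opcart_comp_right (hK : K.PreservedByTensor) (M : 𝒞.Fib (A ⊗ B))
    (N : 𝒞.Fib (B ⊗ C)) (P : 𝒞.Fib (C ⊗ D)) {Z Y W : S} {g : Z ⟶ Y} {b : Z ⟶ B}
    [IsIso (lift g b)] {h : Y ⟶ W} {c : Y ⟶ C} [IsIso (lift h c)] {a : W ⟶ A} {d : W ⟶ D}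
    {a' : Z ⟶ A} {c' : Z ⟶ C} {d' : Z ⟶ D} {k : Z ⟶ W} (w : g ≫ h = k) (ha : k ≫ a = a')
    (hc : g ≫ c = c') (hd : k ≫ d = d') :
    Opcart (evCart _ ha hd) (K.compCell M N a' b c' ▷ ev P c' d' ≫ K.compCell _ P a' c' d') := by
  subst w ha hc hd
  have h₁ := hK.opcart_whiskerRight
    (K.opcart_compCell M N (b := b) (Category.assoc g h a).symm (rfl : g ≫ c = _))
    (evCart P (rfl : g ≫ c = _) (Category.assoc g h d).symm)
  have h₂ := K.opcart_compCell (K.odot M N) P (b := c) (rfl : h ≫ a = _) (rfl : h ≫ d = _)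
  have h₃ := h₁.comp rfl h₂ (evCart _ (Category.assoc g h a).symm (Category.assoc g h d).symm)
  rw [res_compCell] at h₃
  convert h₃ using 1
  exact (cartComp_cartPull _ _ _ _ _).symm

theorem PreservedByTensor.opcart_comp_left (hK : K.PreservedByTensor) (M : 𝒞.Fib (A ⊗ B))
    (N : 𝒞.Fib (B ⊗ C)) (P : 𝒞.Fib (C ⊗ D)) {Z Y W : S} {g : Z ⟶ Y} {c : Z ⟶ C}
    [IsIso (lift g c)] {h : Y ⟶ W} {b : Y ⟶ B} [IsIso (lift h b)] {a : W ⟶ A} {d : W ⟶ D}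
    {a' : Z ⟶ A} {b' : Z ⟶ B} {d' : Z ⟶ D} {k : Z ⟶ W} (w : g ≫ h = k) (ha : k ≫ a = a')
    (hb : g ≫ b = b') (hd : k ≫ d = d') :
    Opcart (evCart _ ha hd) (ev M a' b' ◁ K.compCell N P b' c d' ≫ K.compCell M _ a' b' d') := by
  subst w ha hb hd
  have h₁ := hK.opcart_whiskerLeft
    (K.opcart_compCell N P (b := c) (rfl : g ≫ b = _) (Category.assoc g h d).symm)
    (evCart M (Category.assoc g h a).symm (rfl : g ≫ b = _))
  have h₂ := K.opcart_compCell M (K.odot N P) (b := b) (rfl : h ≫ a = _) (rfl : h ≫ d = _)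
  have h₃ := h₁.comp rfl h₂ (evCart _ (Category.assoc g h a).symm (Category.assoc g h d).symm)
  rw [res_compCell] at h₃
  convert h₃ using 1
  exact (cartComp_cartPull _ _ _ _ _).symm

theorem exists_iso_of_evMap {M N : 𝒞.Fib (A ⊗ B)} (e : ev M (fst A B) (snd A B) ≅
    ev N (fst A B) (snd A B)) : ∃ e' : M ≅ N, evMap e'.hom (fst A B) (snd A B) = e.hom := by
  have := isEquivalence_pull (𝒞 := 𝒞) (lift (fst A B) (snd A B))
  exact ⟨(𝒞.pull (lift (fst A B) (snd A B))).preimageIso e, by simp [evMap]⟩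

theorem PreservedByTensor.exists_associator (hK : K.PreservedByTensor) (M : 𝒞.Fib (A ⊗ B))
    (N : 𝒞.Fib (B ⊗ C)) (P : 𝒞.Fib (C ⊗ D)) :
    ∃ e : K.odot (K.odot M N) P ≅ K.odot M (K.odot N P),
      ∀ {Z : S} (a : Z ⟶ A) (b : Z ⟶ B) (c : Z ⟶ C) (d : Z ⟶ D),
        K.compCell M N a b c ▷ _ ≫ K.compCell _ P a c d ≫ evMap e.hom a d =
          (α_ _ _ _).hom ≫ _ ◁ K.compCell N P b c d ≫ K.compCell M _ a b d := by
  -- This is the universal context for (a, d, c, b). The left bracketing forgets b and then c, the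
  -- right one forgets c (by `g`) and then b; both end with the same map `k`, so the two universal
  -- cells can be compared.
  let k : ((A ⊗ D) ⊗ C) ⊗ B ⟶ A ⊗ D := fst _ _ ≫ fst _ _
  let g : ((A ⊗ D) ⊗ C) ⊗ B ⟶ (A ⊗ D) ⊗ B := lift (fst _ _ ≫ fst _ _) (snd _ _)
  have : IsIso (lift g (fst _ B ≫ snd (A ⊗ D) C)) :=
    ⟨lift (lift (fst _ _ ≫ fst _ _) (snd _ _)) (fst _ _ ≫ snd _ _), by ext <;> simp [g],
      by ext <;> simp [g]⟩
  have h₁ := hK.opcart_comp_right M N P (g := fst _ _) (b := snd _ B) (h := fst _ _)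
    (c := snd (A ⊗ D) C) (a := fst _ _) (d := snd _ _) (k := k) rfl rfl rfl rfl
  have h₂ := hK.opcart_comp_left M N P (g := g) (c := fst _ B ≫ snd (A ⊗ D) C) (h := fst _ _)
    (b := snd (A ⊗ D) B) (a := fst _ _) (d := snd _ _) (b' := snd _ B) (k := k)
    (by simp [g, k]) rfl (by simp [g]) rfl
  obtain ⟨e, he⟩ := h₁.exists_iso (h₂.precomp_iso (α_ _ _ _).hom)
  obtain ⟨e, he'⟩ := exists_iso_of_evMap e
  rw [← he', res_evMap] at he
  refine ⟨e, fun {Z} a b c d => ?_⟩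
  -- The classifying map of (a, b, c, d): restricting the universal identity along it gives the
  -- general one.
  let t : Z ⟶ ((A ⊗ D) ⊗ C) ⊗ B := lift (lift (lift a d) c) b
  have ha : t ≫ k ≫ fst A D = a := by simp [t, k]
  have hb : t ≫ snd _ B = b := by simp [t]
  have hc : t ≫ fst _ B ≫ snd _ C = c := by simp [t]
  have hd : t ≫ k ≫ snd A D = d := by simp [t, k]
  have key := congrArg (res (cartTensor (cartTensor (evCart M ha hb) (evCart N hb hc))
    (evCart P hc hd)) (evCart _ ha hd)) he
  rwa [Category.assoc (_ ▷ _), res_comp _ (cartTensor (evCart _ ha hc) (evCart P hc hd)),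
    res_comp _ (evCart _ ha hd), res_whiskerRight, res_compCell, res_compCell, res_evMap,
    res_comp _ (cartTensor (evCart M ha hb) (cartTensor (evCart N hb hc) (evCart P hc hd))),
    res_comp _ (cartTensor (evCart M ha hb) (evCart _ hb hd)), res_associator_hom,
    res_whiskerLeft, res_compCell, res_compCell] at key

/-- The cell M(a, b) → U(a, a) ⊗ M(a, b) → (U ⊙ M)(a, b) is opcartesian over a composite: duplicate
a, then forget the copy. That composite is the identity, so the cell is invertible; it defines the
inverse of the unitor. -/
theorem PreservedByTensor.exists_leftUnitor (hK : K.PreservedByTensor) (M : 𝒞.Fib (A ⊗ B)) :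
    ∃ e : K.odot (K.unitCell A) M ≅ M, ∀ {Z : S} (a : Z ⟶ A) (b : Z ⟶ B),
      (λ_ _).inv ≫ K.idCell a ▷ _ ≫ K.compCell _ M a a b = evMap e.inv a b := by
  let W := A ⊗ B
  let d : W ⟶ W ⊗ A := lift (𝟙 W) (fst A B)
  have : IsIso (lift (lift (fst W A ≫ fst A B) (snd W A)) (fst W A ≫ snd A B)) :=
    ⟨lift (lift (fst _ _ ≫ fst _ _) (snd _ _)) (fst _ _ ≫ snd _ _),
      by ext <;> simp [W], by ext <;> simp [W]⟩
  have hx : d ≫ fst W A ≫ fst A B = fst A B := by simp [d]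
  have hy : d ≫ snd W A = fst A B := by simp [d]
  have hr : d ≫ fst W A ≫ snd A B = snd A B := by simp [d]
  have hd : d ≫ fst W A = 𝟙 W := by simp [d]
  have h₁ := hK.opcart_whiskerRight (K.opcart_idCell hx hy hr) (evCart M hy hr)
  have h₂ := K.opcart_compCell (K.unitCell A) M (g := fst W A) (b := snd W A) (a := fst A B)
    (c := snd A B) rfl rfl
  have h₃ := h₁.comp rfl h₂ (evCart _ hx hr)
  rw [res_compCell] at h₃
  have := (h₃.precomp_iso (λ_ _).inv).isIso_of_id hd
  obtain ⟨e, he⟩ := exists_iso_of_evMap (asIso ((λ_ (ev M (fst A B) (snd A B))).inv ≫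
    K.idCell (fst A B) ▷ _ ≫ K.compCell _ M (fst A B) (fst A B) (snd A B)))
  refine ⟨e.symm, fun {Z} a b => ?_⟩
  have ha : lift a b ≫ fst A B = a := by simp
  have hb : lift a b ≫ snd A B = b := by simp
  have key := congrArg (res (evCart M ha hb) (evCart _ ha hb)) he
  rw [res_evMap, asIso_hom, res_comp _ (cartTensor (cartUnit _) (evCart M ha hb)),
    res_comp _ (cartTensor (evCart _ ha ha) (evCart M ha hb)), res_leftUnitor_inv,
    res_whiskerRight, res_compCell, res_idCell] at key
  exact key.symm

theorem PreservedByTensor.exists_rightUnitor (hK : K.PreservedByTensor) (M : 𝒞.Fib (A ⊗ B)) :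
    ∃ e : K.odot M (K.unitCell B) ≅ M, ∀ {Z : S} (a : Z ⟶ A) (b : Z ⟶ B),
      (ρ_ _).inv ≫ _ ◁ K.idCell b ≫ K.compCell M _ a b b = evMap e.inv a b := by
  let W := A ⊗ B
  let d : W ⟶ W ⊗ B := lift (𝟙 W) (snd A B)
  have : IsIso (lift (lift (snd W B) (fst W B ≫ snd A B)) (fst W B ≫ fst A B)) :=
    ⟨lift (lift (snd _ _) (fst _ _ ≫ snd _ _)) (fst _ _ ≫ fst _ _),
      by ext <;> simp [W], by ext <;> simp [W]⟩
  have hx : d ≫ snd W B = snd A B := by simp [d]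
  have hy : d ≫ fst W B ≫ snd A B = snd A B := by simp [d]
  have hr : d ≫ fst W B ≫ fst A B = fst A B := by simp [d]
  have hd : d ≫ fst W B = 𝟙 W := by simp [d]
  have h₁ := hK.opcart_whiskerLeft (K.opcart_idCell hx hy hr) (evCart M hr hx)
  have h₂ := K.opcart_compCell M (K.unitCell B) (g := fst W B) (b := snd W B) (a := fst A B)
    (c := snd A B) rfl rfl
  have h₃ := h₁.comp rfl h₂ (evCart _ hr hy)
  rw [res_compCell] at h₃
  have := (h₃.precomp_iso (ρ_ _).inv).isIso_of_id hd
  obtain ⟨e, he⟩ := exists_iso_of_evMap (asIso ((ρ_ (ev M (fst A B) (snd A B))).inv ≫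
    _ ◁ K.idCell (snd A B) ≫ K.compCell M _ (fst A B) (snd A B) (snd A B)))
  refine ⟨e.symm, fun {Z} a b => ?_⟩
  have ha : lift a b ≫ fst A B = a := by simp
  have hb : lift a b ≫ snd A B = b := by simp
  have key := congrArg (res (evCart M ha hb) (evCart _ ha hb)) he
  rw [res_evMap, asIso_hom, res_comp _ (cartTensor (evCart M ha hb) (cartUnit _)),
    res_comp _ (cartTensor (evCart M ha hb) (evCart _ hb hb)), res_rightUnitor_inv,
    res_whiskerLeft, res_compCell, res_idCell] at key
  exact key.symm

theorem opcart_shadowCell_comp (M : 𝒞.Fib (A ⊗ B)) (N : 𝒞.Fib (B ⊗ A)) {Z : S} (a : Z ⟶ A)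
    (b : Z ⟶ B) [IsIso (lift a b)] :
    Opcart (f := toUnit Z) (Iso.refl _) (K.compCell M N a b a ≫ K.shadowCell _ a) := by
  have h := (K.opcart_compCell M N (b := b) (Category.comp_id a) (Category.comp_id a)).comp
    (comp_toUnit a) (K.opcart_shadowCellAux _) (evUnitCart _ a)
  rwa [evUnitCart, cartComp_cartPull_refl_self] at h

/-- Both shadows are the total sum over (a, b) of M(a, b) ⊗ N(b, a), with the factors exchanged by
the braiding. -/
theorem exists_shadowIso (M : 𝒞.Fib (A ⊗ B)) (N : 𝒞.Fib (B ⊗ A)) :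
    ∃ e : (K.shadowFunctor A).obj (K.odot M N) ≅ (K.shadowFunctor B).obj (K.odot N M),
      ∀ {Z : S} (a : Z ⟶ A) (b : Z ⟶ B),
        K.compCell M N a b a ≫ K.shadowCell _ a ≫ evUnitMap Z e.hom =
          (β_ _ _).hom ≫ K.compCell N M b a b ≫ K.shadowCell _ b := by
  obtain ⟨e, he⟩ := (opcart_shadowCell_comp (K := K) M N (fst A B) (snd A B)).exists_iso
    ((opcart_shadowCell_comp N M (snd A B) (fst A B)).precomp_iso (β_ _ _).hom)
  refine ⟨e, fun {Z} a b => ?_⟩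
  have ha : lift a b ≫ fst A B = a := by simp
  have hb : lift a b ≫ snd A B = b := by simp
  have he' : (K.compCell M N (fst A B) (snd A B) (fst A B) ≫ K.shadowCell _ (fst A B)) ≫
      evUnitMap _ e.hom = (β_ _ _).hom ≫ K.compCell N M (snd A B) (fst A B) (snd A B) ≫
        K.shadowCell _ (snd A B) := by
    rw [← he]
    simp [res, evUnitMap]
  have key := congrArg (res (cartTensor (evCart M ha hb) (evCart N hb ha)) (evUnitCart _ _)) he'
  rwa [Category.assoc, res_comp _ (evCart _ ha ha), res_comp _ (evUnitCart _ _), res_compCell,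
    res_shadowCell, res_evUnitMap, res_comp _ (cartTensor (evCart N hb ha) (evCart M ha hb)),
    res_comp _ (evCart _ hb hb), res_braiding_hom, res_compCell, res_shadowCell] at key

end constraints

end IndexedHomotopyCoproducts

end IndexedSymMonCat

/-! ### Coherence axioms, and assembly of the bicategory and its shadow. -/

namespace IndexedSymMonCat

namespace IndexedHomotopyCoproducts

variable {S : Type u} [Category.{v} S] [CartesianMonoidalCategory S]
  {𝒞 : IndexedSymMonCat.{u, v, u', v'} S} {K : 𝒞.IndexedHomotopyCoproducts}

namespace PreservedByTensor

variable (hK : K.PreservedByTensor)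

section associator

variable {A B C D : S} (M M' : 𝒞.Fib (A ⊗ B)) (N N' : 𝒞.Fib (B ⊗ C)) (P P' : 𝒞.Fib (C ⊗ D))

/-- The associativity isomorphism `(M ⊙ N) ⊙ P ≅ M ⊙ (N ⊙ P)`. -/
noncomputable def associator : K.odot (K.odot M N) P ≅ K.odot M (K.odot N P) :=
  (hK.exists_associator M N P).choose

theorem compCell_associator_hom {Z : S} (a : Z ⟶ A) (b : Z ⟶ B) (c : Z ⟶ C) (d : Z ⟶ D) :
    K.compCell M N a b c ▷ _ ≫ K.compCell _ P a c d ≫ evMap (hK.associator M N P).hom a d =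
      (α_ _ _ _).hom ≫ _ ◁ K.compCell N P b c d ≫ K.compCell M _ a b d :=
  (hK.exists_associator M N P).choose_spec a b c d

theorem compCell_associator_inv {Z : S} (a : Z ⟶ A) (b : Z ⟶ B) (c : Z ⟶ C) (d : Z ⟶ D) :
    _ ◁ K.compCell N P b c d ≫ K.compCell M _ a b d ≫ evMap (hK.associator M N P).inv a d =
      (α_ _ _ _).inv ≫ K.compCell M N a b c ▷ _ ≫ K.compCell _ P a c d := by
  rw [Iso.eq_inv_comp, ← reassoc_of% hK.compCell_associator_hom, ← evMap_comp, Iso.hom_inv_id,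
    evMap_id, Category.comp_id]

variable {M M' N N' P P'}

theorem associator_naturality_left (φ : M ⟶ M') :
    K.odotRight (K.odotRight φ N) P ≫ (hK.associator M' N P).hom =
      (hK.associator M N P).hom ≫ K.odotRight φ (K.odot N P) := by
  refine hK.hom_ext₃ fun a b c d => ?_
  simp only [evMap_comp]
  rw [reassoc_of% hK.compCell_associator_hom, compCell_evMap_right,
    reassoc_of% K.compCell_evMap_right, ← comp_whiskerRight_assoc, compCell_evMap_right,
    comp_whiskerRight_assoc, compCell_associator_hom, associator_naturality_left_assoc,
    whisker_exchange_assoc]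

theorem associator_naturality_middle (φ : N ⟶ N') :
    K.odotRight (K.odotLeft M φ) P ≫ (hK.associator M N' P).hom =
      (hK.associator M N P).hom ≫ K.odotLeft M (K.odotRight φ P) := by
  refine hK.hom_ext₃ fun a b c d => ?_
  simp only [evMap_comp]
  rw [reassoc_of% hK.compCell_associator_hom, compCell_evMap_left,
    reassoc_of% K.compCell_evMap_right, ← comp_whiskerRight_assoc, compCell_evMap_left,
    comp_whiskerRight_assoc, compCell_associator_hom, associator_naturality_middle_assoc,
    ← MonoidalCategory.whiskerLeft_comp_assoc, ← compCell_evMap_right,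
    MonoidalCategory.whiskerLeft_comp_assoc]

theorem associator_naturality_right (φ : P ⟶ P') :
    K.odotLeft (K.odot M N) φ ≫ (hK.associator M N P').hom =
      (hK.associator M N P).hom ≫ K.odotLeft M (K.odotLeft N φ) := by
  refine hK.hom_ext₃ fun a b c d => ?_
  simp only [evMap_comp]
  rw [reassoc_of% hK.compCell_associator_hom, compCell_evMap_left,
    reassoc_of% K.compCell_evMap_left, ← whisker_exchange_assoc, compCell_associator_hom,
    associator_naturality_right_assoc, ← MonoidalCategory.whiskerLeft_comp_assoc,
    ← compCell_evMap_left, MonoidalCategory.whiskerLeft_comp_assoc]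

/-- On fourfold cells each associator acts as that of the fibre, so the pentagon in the fibre
remains. -/
theorem pentagon {E : S} (Q : 𝒞.Fib (D ⊗ E)) :
    K.odotRight (hK.associator M N P).hom Q ≫ (hK.associator M (K.odot N P) Q).hom ≫
        K.odotLeft M (hK.associator N P Q).hom =
      (hK.associator (K.odot M N) P Q).hom ≫ (hK.associator M N (K.odot P Q)).hom := by
  refine hK.hom_ext₄ fun a b c d e => ?_
  simp only [evMap_comp]
  rw [reassoc_of% K.compCell_evMap_right, ← comp_whiskerRight_assoc, ← comp_whiskerRight_assoc,
    Category.assoc, compCell_associator_hom, comp_whiskerRight_assoc, comp_whiskerRight_assoc,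
    reassoc_of% hK.compCell_associator_hom, compCell_evMap_left,
    associator_naturality_middle_assoc, ← MonoidalCategory.whiskerLeft_comp_assoc,
    ← MonoidalCategory.whiskerLeft_comp_assoc, Category.assoc (_ ▷ _), compCell_associator_hom]
  rw [reassoc_of% hK.compCell_associator_hom, associator_naturality_left_assoc,
    ← whisker_exchange_assoc, compCell_associator_hom, associator_naturality_right_assoc]
  simp only [MonoidalCategory.whiskerLeft_comp, Category.assoc, pentagon_assoc]

end associator

section unitors

variable {A B C : S} (M M' : 𝒞.Fib (A ⊗ B))

/-- The left unit isomorphism `U ⊙ M ≅ M`. -/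
noncomputable def leftUnitor : K.odot (K.unitCell A) M ≅ M :=
  (hK.exists_leftUnitor M).choose

/-- The right unit isomorphism `M ⊙ U ≅ M`. -/
noncomputable def rightUnitor : K.odot M (K.unitCell B) ≅ M :=
  (hK.exists_rightUnitor M).choose

theorem evMap_leftUnitor_inv {Z : S} (a : Z ⟶ A) (b : Z ⟶ B) :
    evMap (hK.leftUnitor M).inv a b = (λ_ _).inv ≫ K.idCell a ▷ _ ≫ K.compCell _ M a a b :=
  ((hK.exists_leftUnitor M).choose_spec a b).symm

theorem evMap_rightUnitor_inv {Z : S} (a : Z ⟶ A) (b : Z ⟶ B) :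
    evMap (hK.rightUnitor M).inv a b = (ρ_ _).inv ≫ _ ◁ K.idCell b ≫ K.compCell M _ a b b :=
  ((hK.exists_rightUnitor M).choose_spec a b).symm

theorem idCell_compCell_leftUnitor_hom {Z : S} (a : Z ⟶ A) (b : Z ⟶ B) :
    K.idCell a ▷ _ ≫ K.compCell _ M a a b ≫ evMap (hK.leftUnitor M).hom a b = (λ_ _).hom := by
  have h := congrArg (· ≫ evMap (hK.leftUnitor M).hom a b) (hK.evMap_leftUnitor_inv M a b)
  simp only [← evMap_comp, Iso.inv_hom_id, evMap_id, Category.assoc] at h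
  rw [← (Iso.eq_inv_comp _).1 h, Category.comp_id]

theorem idCell_compCell_rightUnitor_hom {Z : S} (a : Z ⟶ A) (b : Z ⟶ B) :
    _ ◁ K.idCell b ≫ K.compCell M _ a b b ≫ evMap (hK.rightUnitor M).hom a b = (ρ_ _).hom := by
  have h := congrArg (· ≫ evMap (hK.rightUnitor M).hom a b) (hK.evMap_rightUnitor_inv M a b)
  simp only [← evMap_comp, Iso.inv_hom_id, evMap_id, Category.assoc] at h
  rw [← (Iso.eq_inv_comp _).1 h, Category.comp_id]

variable {M M'}

theorem leftUnitor_inv_naturality (φ : M ⟶ M') :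
    (hK.leftUnitor M).inv ≫ K.odotLeft _ φ = φ ≫ (hK.leftUnitor M').inv := by
  refine evMap_ext ?_
  simp only [evMap_comp, evMap_leftUnitor_inv, Category.assoc]
  rw [compCell_evMap_left, ← whisker_exchange_assoc, leftUnitor_inv_naturality_assoc]

theorem rightUnitor_inv_naturality (φ : M ⟶ M') :
    (hK.rightUnitor M).inv ≫ K.odotRight φ _ = φ ≫ (hK.rightUnitor M').inv := by
  refine evMap_ext ?_
  simp only [evMap_comp, evMap_rightUnitor_inv, Category.assoc]
  rw [compCell_evMap_right, whisker_exchange_assoc, rightUnitor_inv_naturality_assoc]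

theorem triangle (N : 𝒞.Fib (B ⊗ C)) :
    (hK.associator M (K.unitCell B) N).hom ≫ K.odotLeft M (hK.leftUnitor N).hom =
      K.odotRight (hK.rightUnitor M).hom N := by
  have h : IsIso (K.odotRight (hK.rightUnitor M).inv N) :=
    inferInstanceAs (IsIso (((K.composition A B C).map (hK.rightUnitor M).inv).app N))
  -- The unitors are known on cells through their inverses; this exposes M(a, b) ⊗ N(b, c) with an
  -- inserted unit, where the triangle of the fibre applies.
  rw [← cancel_epi (K.odotRight (hK.rightUnitor M).inv N)]
  refine hom_ext₂ fun a b c => ?_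
  simp only [evMap_comp]
  rw [reassoc_of% K.compCell_evMap_right, reassoc_of% K.compCell_evMap_right,
    K.compCell_evMap_right _ (hK.rightUnitor M).hom, ← comp_whiskerRight_assoc,
    ← evMap_comp (hK.rightUnitor M).inv, Iso.inv_hom_id, evMap_id, evMap_rightUnitor_inv]
  simp only [comp_whiskerRight, Category.assoc, id_whiskerRight, Category.id_comp]
  rw [reassoc_of% hK.compCell_associator_hom, compCell_evMap_left,
    associator_naturality_middle_assoc, ← MonoidalCategory.whiskerLeft_comp_assoc,
    ← MonoidalCategory.whiskerLeft_comp_assoc, Category.assoc, idCell_compCell_leftUnitor_hom,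
    MonoidalCategory.triangle_assoc, ← comp_whiskerRight_assoc, Iso.inv_hom_id, id_whiskerRight,
    Category.id_comp]

end unitors

section shadow

variable (K) {A B C : S}

/-- The isomorphism `⟨M ⊙ N⟩ ≅ ⟨N ⊙ M⟩`. -/
noncomputable def shadowIso (M : 𝒞.Fib (A ⊗ B)) (N : 𝒞.Fib (B ⊗ A)) :
    (K.shadowFunctor A).obj (K.odot M N) ≅ (K.shadowFunctor B).obj (K.odot N M) :=
  (exists_shadowIso (K := K) M N).choose

theorem shadowCell_shadowIso_hom (M : 𝒞.Fib (A ⊗ B)) (N : 𝒞.Fib (B ⊗ A)) {Z : S} (a : Z ⟶ A)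
    (b : Z ⟶ B) : K.compCell M N a b a ≫ K.shadowCell _ a ≫ evUnitMap Z (shadowIso K M N).hom =
      (β_ _ _).hom ≫ K.compCell N M b a b ≫ K.shadowCell _ b :=
  (exists_shadowIso (K := K) M N).choose_spec a b

theorem shadowIso_naturality_left {M M' : 𝒞.Fib (A ⊗ B)} (φ : M ⟶ M') (N : 𝒞.Fib (B ⊗ A)) :
    (K.shadowFunctor A).map (K.odotRight φ N) ≫ (shadowIso K M' N).hom =
      (shadowIso K M N).hom ≫ (K.shadowFunctor B).map (K.odotLeft N φ) := by
  refine shadow_hom_ext₂ fun a b => ?_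
  simp only [evUnitMap_comp]
  rw [reassoc_of% K.shadowCell_evUnitMap, reassoc_of% K.compCell_evMap_right,
    shadowCell_shadowIso_hom, reassoc_of% shadowCell_shadowIso_hom K, shadowCell_evUnitMap,
    reassoc_of% K.compCell_evMap_left, BraidedCategory.braiding_naturality_left_assoc]

theorem shadowIso_naturality_right (M : 𝒞.Fib (A ⊗ B)) {N N' : 𝒞.Fib (B ⊗ A)} (φ : N ⟶ N') :
    (K.shadowFunctor A).map (K.odotLeft M φ) ≫ (shadowIso K M N').hom =
      (shadowIso K M N).hom ≫ (K.shadowFunctor B).map (K.odotRight φ M) := by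
  refine shadow_hom_ext₂ fun a b => ?_
  simp only [evUnitMap_comp]
  rw [reassoc_of% K.shadowCell_evUnitMap, reassoc_of% K.compCell_evMap_left,
    shadowCell_shadowIso_hom, reassoc_of% shadowCell_shadowIso_hom K, shadowCell_evUnitMap,
    reassoc_of% K.compCell_evMap_right, BraidedCategory.braiding_naturality_right_assoc]

/-- Moving Z to the front equals moving X and then Y to the end. The two moves also exchange X and Y
twice, which cancels by symmetry of the braiding. This is the shadow hexagon on cells. -/
theorem braiding_cyclic {V : Type*} [Category* V] [MonoidalCategory V] [SymmetricCategory V]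
    (X Y Z : V) : (β_ (X ⊗ Y) Z).hom ≫ (α_ Z X Y).inv =
      (α_ X Y Z).hom ≫ (β_ X (Y ⊗ Z)).hom ≫ (α_ Y Z X).hom ≫ (β_ Y (Z ⊗ X)).hom := by
  have h : (β_ X Y).hom ▷ Z ≫ (β_ Y X).hom ▷ Z = 𝟙 _ := by
    rw [← comp_whiskerRight, SymmetricCategory.symmetry, id_whiskerRight]
  rw [BraidedCategory.braiding_tensor_left_hom, BraidedCategory.braiding_tensor_right_hom X Y Z]
  simp only [Category.assoc, Iso.hom_inv_id_assoc, Iso.inv_hom_id_assoc, Iso.hom_inv_id,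
    Category.comp_id]
  rw [BraidedCategory.braiding_naturality_right, BraidedCategory.braiding_tensor_right_hom Y X Z]
  simp only [Category.assoc, Iso.hom_inv_id_assoc, reassoc_of% h]

variable {K}

theorem shadow_hexagon (M : 𝒞.Fib (A ⊗ B)) (N : 𝒞.Fib (B ⊗ C)) (P : 𝒞.Fib (C ⊗ A)) :
    (shadowIso K (K.odot M N) P).hom ≫ (K.shadowFunctor C).map (hK.associator P M N).inv =
      (K.shadowFunctor A).map (hK.associator M N P).hom ≫ (shadowIso K M (K.odot N P)).hom ≫
        (K.shadowFunctor B).map (hK.associator N P M).hom ≫ (shadowIso K N (K.odot P M)).hom := by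
  refine hK.shadow_hom_ext₃ fun a b c => ?_
  simp only [evUnitMap_comp]
  rw [reassoc_of% shadowCell_shadowIso_hom K, shadowCell_evUnitMap,
    BraidedCategory.braiding_naturality_left_assoc, reassoc_of% hK.compCell_associator_inv,
    reassoc_of% K.shadowCell_evUnitMap, reassoc_of% hK.compCell_associator_hom,
    reassoc_of% shadowCell_shadowIso_hom K, BraidedCategory.braiding_naturality_right_assoc,
    reassoc_of% K.shadowCell_evUnitMap, reassoc_of% hK.compCell_associator_hom,
    shadowCell_shadowIso_hom, BraidedCategory.braiding_naturality_right_assoc,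
    reassoc_of% braiding_cyclic]

/-- After precomposing with the inverse right unitor, the claim on cells is that the right unitor
inverse, the braiding and the left unitor compose to the identity. -/
theorem shadow_unit_right (M : 𝒞.Fib (A ⊗ A)) :
    (shadowIso K M (K.unitCell A)).hom ≫ (K.shadowFunctor A).map (hK.leftUnitor M).hom =
      (K.shadowFunctor A).map (hK.rightUnitor M).hom := by
  rw [← cancel_epi ((K.shadowFunctor A).map (hK.rightUnitor M).inv), ← Functor.map_comp,
    Iso.inv_hom_id, CategoryTheory.Functor.map_id]
  refine shadow_hom_ext₁ fun a => ?_
  simp only [evUnitMap_comp]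
  rw [reassoc_of% K.shadowCell_evUnitMap, evMap_rightUnitor_inv, Category.assoc, Category.assoc,
    reassoc_of% shadowCell_shadowIso_hom K, shadowCell_evUnitMap,
    BraidedCategory.braiding_naturality_right_assoc,
    reassoc_of% hK.idCell_compCell_leftUnitor_hom, evUnitMap_id, Category.comp_id]
  simp

theorem shadow_unit_left (M : 𝒞.Fib (A ⊗ A)) :
    (shadowIso K (K.unitCell A) M).hom ≫ (K.shadowFunctor A).map (hK.rightUnitor M).hom =
      (K.shadowFunctor A).map (hK.leftUnitor M).hom := by
  rw [← cancel_epi ((K.shadowFunctor A).map (hK.leftUnitor M).inv), ← Functor.map_comp,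
    Iso.inv_hom_id, CategoryTheory.Functor.map_id]
  refine shadow_hom_ext₁ fun a => ?_
  simp only [evUnitMap_comp]
  rw [reassoc_of% K.shadowCell_evUnitMap, evMap_leftUnitor_inv, Category.assoc, Category.assoc,
    reassoc_of% shadowCell_shadowIso_hom K, shadowCell_evUnitMap,
    BraidedCategory.braiding_naturality_left_assoc,
    reassoc_of% hK.idCell_compCell_rightUnitor_hom, evUnitMap_id, Category.comp_id]
  simp

end shadow

section bicategory

/-- The bicategory `𝒞/S`. -/
@[reducible]
noncomputable def bicategory : Bicategory.{v', u'} S where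
  Hom A B := 𝒞.Fib (A ⊗ B)
  id A := K.unitCell A
  comp M N := K.odot M N
  homCategory A B := 𝒞.cat (A ⊗ B)
  whiskerLeft M _ _ ψ := K.odotLeft M ψ
  whiskerRight φ N := K.odotRight φ N
  associator M N P := hK.associator M N P
  leftUnitor M := hK.leftUnitor M
  rightUnitor M := hK.rightUnitor M
  whiskerLeft_id M N := ((K.composition _ _ _).obj M).map_id N
  whiskerLeft_comp M _ _ _ φ ψ := ((K.composition _ _ _).obj M).map_comp φ ψ
  id_whiskerLeft φ := (Iso.inv_comp_eq _).1 (hK.leftUnitor_inv_naturality φ)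
  comp_whiskerLeft M N _ _ φ := by
    have := (Iso.eq_comp_inv _).2 (hK.associator_naturality_right (M := M) (N := N) φ)
    exact this.trans (Category.assoc _ _ _)
  id_whiskerRight M N := NatTrans.congr_app ((K.composition _ _ _).map_id M) N
  comp_whiskerRight φ ψ N := NatTrans.congr_app ((K.composition _ _ _).map_comp φ ψ) N
  whiskerRight_id φ := (Iso.inv_comp_eq _).1 (hK.rightUnitor_inv_naturality φ)
  whiskerRight_comp φ N P :=
    (Iso.eq_inv_comp _).2 (hK.associator_naturality_left (N := N) (P := P) φ).symm
  whisker_assoc M _ _ φ P := by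
    have := (Iso.eq_comp_inv _).2 (hK.associator_naturality_middle (M := M) (P := P) φ)
    exact this.trans (Category.assoc _ _ _)
  whisker_exchange φ ψ := ((K.composition _ _ _).map φ).naturality ψ
  pentagon M N P Q := hK.pentagon (M := M) (N := N) (P := P) Q
  triangle M N := hK.triangle (M := M) N

/-- The shadow on `𝒞/S` with values in the fibre over the terminal object. -/
noncomputable def shadow : ShadowFunctor hK.bicategory (𝒞.Fib (𝟙_ S)) where
  sh A := K.shadowFunctor A
  θ M N := shadowIso K M N
  θ_natural_left φ N := shadowIso_naturality_left K φ N
  θ_natural_right M _ _ φ := shadowIso_naturality_right K M φ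
  hexagon M N P := hK.shadow_hexagon M N P
  unit_right M := hK.shadow_unit_right M
  unit_left M := hK.shadow_unit_left M

end bicategory

end PreservedByTensor

end IndexedHomotopyCoproducts

end IndexedSymMonCat

/-- There is a bicategory with a shadow whose 0-cells are the objects of `S`, and whose
hom-categories, composition functors, units and shadow functors are the prescribed ones. -/
theorem mainTheorem1 {S : Type u} [Category.{v} S] [CartesianMonoidalCategory S]
    (𝒞 : IndexedSymMonCat.{u, v, u', v'} S) (K : 𝒞.IndexedHomotopyCoproducts)
    (hK : K.PreservedByTensor) :
    ∃ (ℬ : Bicategory.{v', u'} S) (σ : ShadowFunctor ℬ (𝒞.Fib (𝟙_ S))),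
      σ.underlyingData = K.bicategoryData :=
  -- Only the constraint isomorphisms involved a choice; the underlying data are the prescribed ones
  -- by definition.
  ⟨hK.bicategory, hK.shadow, rfl⟩
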